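/- Let $K$ be an algebraically closed field, $Q$ a finite quiver with vertex set $Q_0$ and arrow set $Q_1$, $I$ an admissible ideal of the path algebra $KQ$, $A=KQ/I$, and let $\leqslant$ be a partial order on $Q_0$. For $i\in Q_0$ let $e_i$ be the trivial path at $i$, let $P(i)=Ae_i$, $I(i)=\operatorname{Hom}_K(e_iA,K)$ and $S(i)=P(i)/\operatorname{rad}P(i)$ be the corresponding projective indecomposable, injective indecomposable and simple left $A$-modules, and write $[M:S(i)]=\dim_K e_iM$. The standard module $\Delta(i)$ is the largest factor module of $P(i)$ with $[\Delta(i):S(j)]=0$ for all $j\not\leqslant i$, and the costandard module $\nabla(i)$ is the largest submodule of $I(i)$ with $[\nabla(i):S(j)]=0$ for all $j\not\leqslant i$. A $\Delta$-good filtration of a module is a finite filtration all of whose subquotients are isomorphic to standard modules; $(M:\Delta(j))$ denotes the number of subquotients isomorphic to $\Delta(j)$ in such a filtration of $M$. Assume that $(A,\leqslant)$ is quasi-hereditary, that is, for all $i\in Q_0$: $[\Delta(i):S(i)]=1$, and $P(i)$ has a $\Delta$-good filtration, with $(P(i):\Delta(j))=0$ for all $j\not\geqslant i$ and $(P(i):\Delta(i))=1$.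 Assume moreover that $(A,\leqslant)$ is $1$-quasi-hereditary, that is: 1. $(Q_0,\leqslant)$ has a smallest element $1$ and a largest element $n$; 2. $[\Delta(i):S(j)]=(P(j):\Delta(i))=1$ for all $j\leqslant i$; 3. $\operatorname{soc}P(j)\cong\operatorname{top}I(j)\cong S(1)$ for all $j$; 4. for all $i$ there are an injective homomorphism $\Delta(i)\hookrightarrow\Delta(n)$ and a surjective homomorphism $\nabla(n)\twoheadrightarrow\nabla(i)$. Call $i,j\in Q_0$ neighbours if one of them covers the other with respect to $\leqslant$, that is, $i<j$ or $j<i$ and no element lies strictly between them. Then $Q$ is the $\operatorname{Ext}$-quiver of $A$, i.e. $\dim_K\operatorname{Ext}^1_A(S(i),S(j))$ is the number of arrows $i\to j$ in $Q$ for all $i,j\in Q_0$; two vertices $i,j$ are connected by an arrow (in at least one direction) if and only if they are neighbours; and if $i$ and $j$ are neighbours, then there is exactly one arrow $i\to j$ and exactly one arrow $j\to i$. In other words, the $\operatorname{Ext}$-quiver of $A$ is the double of the Hasse diagram of $(Q_0,\leqslant)$. -/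

import Mathlib

open CategoryTheory

universe u v w x

/-! ## The path algebra of a finite quiver -/

/-- The set of all paths of a quiver `V`: a path is a triple `⟨source, target, path⟩`. -/
abbrev QPath (V : Type v) [Quiver.{w} V] : Type (max v w) :=
  Σ a b : V, Quiver.Path a b

namespace QPath

variable {V : Type v} [Quiver.{w} V]

/-- The trivial path at the vertex `i`. -/
def triv (i : V) : QPath V := ⟨i, i, Quiver.Path.nil⟩

/-- The length (number of arrows) of a path. -/
def length (p : QPath V) : ℕ := p.2.2.length

open Classical in
/-- The partial product `q · p` of paths: first run through `p`, then through `q`.  It is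
`none` unless `p` ends where `q` starts. -/
noncomputable def mul? (q p : QPath V) : Option (QPath V) :=
  if h : q.1 = p.2.1 then some ⟨p.1, q.2.1, p.2.2.comp (h ▸ q.2.2)⟩ else none

theorem mul?_pos {a b c : V} (q : Quiver.Path b c) (p : Quiver.Path a b) :
    mul? (⟨b, c, q⟩ : QPath V) ⟨a, b, p⟩ = some ⟨a, c, p.comp q⟩ := by
  simp [mul?]

theorem mul?_neg {a b b' c : V} (q : Quiver.Path b' c) (p : Quiver.Path a b) (h : b' ≠ b) :
    mul? (⟨b', c, q⟩ : QPath V) ⟨a, b, p⟩ = none := by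
  simp [mul?, h]

theorem mul?_assoc (r q p : QPath V) :
    ((mul? r q).bind fun t => mul? t p) = (mul? q p).bind fun t => mul? r t := by
  obtain ⟨a, b, p⟩ := p
  obtain ⟨b', c, q⟩ := q
  obtain ⟨c', d, r⟩ := r
  by_cases h1 : b' = b
  · subst h1
    by_cases h2 : c' = c
    · subst h2
      simp [mul?_pos, Quiver.Path.comp_assoc]
    · simp [mul?_pos, mul?_neg _ _ h2]
  · by_cases h2 : c' = c
    · subst h2
      simp [mul?_pos, mul?_neg _ _ h1]
    · simp [mul?_neg _ _ h2, mul?_neg _ _ h1]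

end QPath

/-- The path algebra `K V` of a quiver `V`: the `K`-vector space with basis the set of all paths
of the quiver. -/
def PathAlgebra (K : Type u) (V : Type v) [Field K] [Quiver.{w} V] : Type (max u v w) :=
  QPath V →₀ K

namespace PathAlgebra

variable (K : Type u) {V : Type v} [Field K] [Quiver.{w} V]

noncomputable instance : AddCommGroup (PathAlgebra K V) :=
  inferInstanceAs (AddCommGroup (QPath V →₀ K))

noncomputable instance : Module K (PathAlgebra K V) :=
  inferInstanceAs (Module K (QPath V →₀ K))

/-- A path as an element of the path algebra. -/
noncomputable def ofPath (p : QPath V) : PathAlgebra K V := Finsupp.single p 1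

/-- The trivial path `e i` as an element of the path algebra. -/
noncomputable def idem (i : V) : PathAlgebra K V := ofPath K (QPath.triv i)

/-- The paths form a basis of the path algebra. -/
noncomputable def basis : Module.Basis (QPath V) K (PathAlgebra K V) :=
  Module.Basis.ofRepr (LinearEquiv.refl K (QPath V →₀ K))

theorem basis_apply (p : QPath V) : basis K p = ofPath K p := rfl

/-- A path or zero. -/
noncomputable def ofOption (o : Option (QPath V)) : PathAlgebra K V :=
  o.elim 0 (ofPath K)

/-- Multiplication of the path algebra: the bilinear extension of the concatenation of paths,
where the product of two paths that do not fit together is zero. -/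
noncomputable def mulHom : PathAlgebra K V →ₗ[K] PathAlgebra K V →ₗ[K] PathAlgebra K V :=
  (basis K).constr K fun q => (basis K).constr K fun p => ofOption K (QPath.mul? q p)

noncomputable instance : Mul (PathAlgebra K V) := ⟨fun x y => mulHom K x y⟩

/-- The unit of the path algebra is the sum of the trivial paths. -/
noncomputable instance [Fintype V] : One (PathAlgebra K V) := ⟨∑ i : V, idem K i⟩

theorem mul_def (x y : PathAlgebra K V) : x * y = mulHom K x y := rfl

theorem one_def [Fintype V] : (1 : PathAlgebra K V) = ∑ i : V, idem K i := rfl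

theorem ofPath_mul (q p : QPath V) : ofPath K q * ofPath K p = ofOption K (QPath.mul? q p) := by
  rw [mul_def, ← basis_apply, ← basis_apply, mulHom, Module.Basis.constr_basis,
    Module.Basis.constr_basis]

theorem ofOption_mul (o : Option (QPath V)) (p : QPath V) :
    ofOption K o * ofPath K p = ofOption K (o.bind fun t => QPath.mul? t p) := by
  cases o with
  | none => simp [ofOption, mul_def]
  | some t => exact ofPath_mul K t p

theorem mul_ofOption (q : QPath V) (o : Option (QPath V)) :
    ofPath K q * ofOption K o = ofOption K (o.bind fun t => QPath.mul? q t) := by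
  cases o with
  | none => simp [ofOption, mul_def]
  | some t => exact ofPath_mul K q t

theorem mul_assoc' (x y z : PathAlgebra K V) : x * y * z = x * (y * z) := by
  have h : (mulHom K).compr₂ (mulHom K) =
      (LinearMap.llcomp K (PathAlgebra K V) (PathAlgebra K V) (PathAlgebra K V)).compl₁₂
        (mulHom K) (mulHom K) := by
    refine (basis K).ext fun r => (basis K).ext fun q => (basis K).ext fun p => ?_
    change ofPath K r * ofPath K q * ofPath K p = ofPath K r * (ofPath K q * ofPath K p)
    rw [ofPath_mul, ofPath_mul, ofOption_mul, mul_ofOption, QPath.mul?_assoc]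
  exact congrArg (fun f => f x y z) h

theorem idem_mul_ofPath [DecidableEq V] (i : V) (p : QPath V) :
    idem K i * ofPath K p = if i = p.2.1 then ofPath K p else 0 := by
  obtain ⟨a, b, p⟩ := p
  rw [idem, ofPath_mul]
  split_ifs with h
  · have h : i = b := h
    subst h
    rw [QPath.triv, QPath.mul?_pos]
    simp [ofOption]
  · rw [QPath.triv, QPath.mul?_neg _ _ h]
    rfl

theorem ofPath_mul_idem [DecidableEq V] (p : QPath V) (i : V) :
    ofPath K p * idem K i = if p.1 = i then ofPath K p else 0 := by
  obtain ⟨a, b, p⟩ := p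
  rw [idem, ofPath_mul]
  split_ifs with h
  · have h : a = i := h
    subst h
    rw [QPath.triv, QPath.mul?_pos]
    simp [ofOption]
  · rw [QPath.triv, QPath.mul?_neg _ _ h]
    rfl

theorem one_mul' [Fintype V] (x : PathAlgebra K V) : 1 * x = x := by
  classical
  have h : mulHom K (1 : PathAlgebra K V) = LinearMap.id := by
    refine (basis K).ext fun p => ?_
    change (1 : PathAlgebra K V) * ofPath K p = ofPath K p
    rw [one_def, mul_def, map_sum, LinearMap.sum_apply]
    simp only [← mul_def, idem_mul_ofPath]
    simp
  exact congrArg (fun f => f x) h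

theorem mul_one' [Fintype V] (x : PathAlgebra K V) : x * 1 = x := by
  classical
  have h : (mulHom K).flip (1 : PathAlgebra K V) = LinearMap.id := by
    refine (basis K).ext fun p => ?_
    change ofPath K p * (1 : PathAlgebra K V) = ofPath K p
    rw [one_def, mul_def, map_sum]
    simp only [← mul_def, ofPath_mul_idem]
    simp
  exact congrArg (fun f => f x) h

noncomputable instance [Fintype V] : Ring (PathAlgebra K V) where
  __ := (inferInstance : AddCommGroup (PathAlgebra K V))
  mul := (· * ·)
  one := 1
  mul_assoc := mul_assoc' K
  one_mul := one_mul' K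
  mul_one := mul_one' K
  left_distrib x y z := map_add (mulHom K x) y z
  right_distrib x y z := LinearMap.map_add₂ (mulHom K) x y z
  zero_mul x := LinearMap.map_zero₂ (mulHom K) x
  mul_zero x := map_zero (mulHom K x)

noncomputable instance [Fintype V] : Algebra K (PathAlgebra K V) :=
  Algebra.ofModule (fun r x y => LinearMap.map_smul₂ (mulHom K) r x y)
    (fun r x y => map_smul (mulHom K x) r y)

/-- The `m`-th power of the arrow ideal: the span of all paths of length at least `m`. -/
noncomputable def arrowPow (V : Type v) [Quiver.{w} V] (m : ℕ) : Submodule K (PathAlgebra K V) :=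
  Submodule.span K {y | ∃ p : QPath V, m ≤ p.length ∧ y = ofPath K p}

variable {K}

/-- A two-sided ideal `I` of the path algebra is admissible if `Rᵐ ⊆ I ⊆ R²` for some `m ≥ 2`,
where `R` is the ideal generated by the arrows. -/
def IsAdmissible [Fintype V] (I : Ideal (PathAlgebra K V)) : Prop :=
  I.IsTwoSided ∧ (∀ y ∈ I, y ∈ arrowPow K V 2) ∧ ∃ m : ℕ, 2 ≤ m ∧ ∀ y ∈ arrowPow K V m, y ∈ I

/-- The image of the trivial path at the vertex `i` in the algebra `K V / I`. -/
noncomputable def quotIdem [Fintype V] (I : Ideal (PathAlgebra K V)) [I.IsTwoSided] (i : V) :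
    PathAlgebra K V ⧸ I :=
  Ideal.Quotient.mk I (idem K i)

end PathAlgebra

/-! ## Modules over a finite-dimensional algebra

In this part `A` is a `K`-algebra and `e : V → A` is a family of elements; in the applications
`A = K V / I` is a bound quiver algebra and `e i` is the class of the trivial path at `i`. -/

/-- The top `M / rad M` of a module. -/
abbrev ModTop (A : Type w) [Ring A] (M : Type x) [AddCommGroup M] [Module A M] : Type x :=
  M ⧸ Module.jacobson A M

/-- The socle of a module: the sum of its simple submodules. -/
def modSocle (A : Type w) [Ring A] (M : Type x) [AddCommGroup M] [Module A M] : Submodule A M :=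
  sSup {N | IsSimpleModule A N}

section Modules

variable (K : Type u) [Field K] {A : Type w} [Ring A] [Algebra K A] {V : Type v} (e : V → A)

/-- The projective module `P(i) = A e_i`. -/
abbrev projMod (i : V) : Submodule A A := Submodule.span A {e i}

/-- The simple module `S(i) = P(i) / rad P(i)`. -/
abbrev simpleMod (i : V) : Type w := ModTop A (projMod e i)

/-- The Jordan-Hölder multiplicity `[M : S(i)]`, that is, the dimension over `K` of
`M_i = e_i M`. -/
noncomputable def jhMult (M : Type x) [AddCommGroup M] [Module K M] [Module A M]
    [IsScalarTower K A M] (i : V) : ℕ :=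
  Module.finrank K (LinearMap.range (Algebra.lsmul K K M (e i)))

variable (A) in
/-- The dual `D(A) = Hom_K(A, K)` of the right regular module. -/
def DualRegular : Type (max u w) := A →ₗ[K] K

namespace DualRegular

noncomputable instance : AddCommGroup (DualRegular K A) := inferInstanceAs (AddCommGroup (A →ₗ[K] K))

noncomputable instance : Module K (DualRegular K A) := inferInstanceAs (Module K (A →ₗ[K] K))

variable {K} in
/-- The linear form underlying an element of `D(A)`. -/
def toForm (f : DualRegular K A) : A →ₗ[K] K := f

/-- The left `A`-module structure of `D(A)`: `(a • f) y = f (y * a)`. -/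
noncomputable instance : Module A (DualRegular K A) where
  smul a f := (toForm f).comp (LinearMap.mulRight K a)
  one_smul f := LinearMap.ext fun y => congrArg (toForm f) (mul_one y)
  mul_smul a b f := LinearMap.ext fun y => congrArg (toForm f) (mul_assoc y a b).symm
  smul_zero _ := rfl
  smul_add _ _ _ := rfl
  add_smul a b f := LinearMap.ext fun y =>
    (congrArg (toForm f) (mul_add y a b)).trans (map_add (toForm f) (y * a) (y * b))
  zero_smul f := LinearMap.ext fun y =>
    (congrArg (toForm f) (mul_zero y)).trans (map_zero (toForm f))

theorem smul_toForm (a : A) (f : DualRegular K A) (y : A) :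
    toForm (a • f) y = toForm f (y * a) := rfl

instance : IsScalarTower K A (DualRegular K A) where
  smul_assoc k a f := LinearMap.ext fun y =>
    (congrArg (toForm f) (mul_smul_comm k y a)).trans (map_smul (toForm f) k (y * a))

end DualRegular

/-- The injective module `I(i) = D(e_i A)`, realized inside `D(A)` as the set of those forms `f`
that factor through the projection `A → e_i A`, `y ↦ e_i y`. -/
def injMod (i : V) : Submodule A (DualRegular K A) where
  carrier := {f | ∀ y : A, DualRegular.toForm f (e i * y) = DualRegular.toForm f y}
  add_mem' {f g} hf hg y := by
    change DualRegular.toForm f (e i * y) + DualRegular.toForm g (e i * y) =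
      DualRegular.toForm f y + DualRegular.toForm g y
    rw [hf y, hg y]
  zero_mem' _ := rfl
  smul_mem' a f hf y := by
    rw [DualRegular.smul_toForm, DualRegular.smul_toForm, mul_assoc]
    exact hf (y * a)

variable [PartialOrder V]

/-- The kernel of `P(i) → Δ(i)`: the smallest submodule `N` of `P(i)` such that
`[P(i)/N : S(j)] = 0` for all `j` with `j ≰ i`. -/
noncomputable def stdKer (i : V) : Submodule A (projMod e i) :=
  sInf {N | ∀ j : V, ¬ j ≤ i → jhMult K e (projMod e i ⧸ N) j = 0}

/-- The standard module `Δ(i)`: the largest factor module of `P(i)` such that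
`[Δ(i) : S(j)] = 0` for all `j` with `j ≰ i`. -/
abbrev stdMod (i : V) : Type w := projMod e i ⧸ stdKer K e i

/-- The costandard module `∇(i)`: the largest submodule of `I(i)` such that
`[∇(i) : S(j)] = 0` for all `j` with `j ≰ i`. -/
noncomputable def costdMod (i : V) : Submodule A (injMod K e i) :=
  sSup {N | ∀ j : V, ¬ j ≤ i → jhMult K e N j = 0}

/-- A `Δ`-good filtration `0 = M₀ ⊆ M₁ ⊆ ⋯ ⊆ M_r = M` of a module `M`: the subquotient
`M_{k+1} / M_k` is isomorphic to the standard module `Δ(label k)`. -/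
structure StdFiltration (M : Type x) [AddCommGroup M] [Module A M] where
  /-- the number of subquotients -/
  len : ℕ
  /-- the submodules -/
  sub : Fin (len + 1) → Submodule A M
  mono : Monotone sub
  sub_zero : sub 0 = ⊥
  sub_last : sub (Fin.last len) = ⊤
  /-- the labels of the subquotients -/
  label : Fin len → V
  iso : ∀ k : Fin len, Nonempty
    ((sub k.succ ⧸ (sub k.castSucc).comap (sub k.succ).subtype) ≃ₗ[A] stdMod K e (label k))

variable {K e} in
/-- The number of subquotients isomorphic to `Δ(j)` in a `Δ`-good filtration, counted by labels. -/
noncomputable def StdFiltration.mult {M : Type x} [AddCommGroup M] [Module A M]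
    (F : StdFiltration K e M) (j : V) : ℕ :=
  Nat.card {k : Fin F.len // F.label k = j}

/-- `(A, ≤)` is quasi-hereditary: for all `i`, `[Δ(i) : S(i)] = 1` and `P(i)` has a `Δ`-good
filtration with `(P(i) : Δ(j)) = 0` for `j ≱ i` and `(P(i) : Δ(i)) = 1`. -/
structure IsQuasiHereditary : Prop where
  std_self : ∀ i : V, jhMult K e (stdMod K e i) i = 1
  proj_good : ∀ i : V, ∃ F : StdFiltration K e (projMod e i),
    (∀ j : V, ¬ i ≤ j → F.mult j = 0) ∧ F.mult i = 1

/-- `(A, ≤)` is 1-quasi-hereditary. -/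
structure IsOneQuasiHereditary : Prop extends IsQuasiHereditary K e where
  exists_least : ∃ b : V, IsBot b
  exists_greatest : ∃ t : V, IsTop t
  std_mult : ∀ i j : V, j ≤ i → jhMult K e (stdMod K e i) j = 1
  proj_mult : ∀ i j : V, j ≤ i → ∃ F : StdFiltration K e (projMod e j), F.mult i = 1
  socle_proj : ∀ b : V, IsBot b → ∀ j : V,
    Nonempty (modSocle A (projMod e j) ≃ₗ[A] simpleMod e b)
  top_inj : ∀ b : V, IsBot b → ∀ j : V,
    Nonempty (ModTop A (injMod K e j) ≃ₗ[A] simpleMod e b)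
  std_embeds : ∀ t : V, IsTop t → ∀ i : V,
    ∃ f : stdMod K e i →ₗ[A] stdMod K e t, Function.Injective f
  costd_onto : ∀ t : V, IsTop t → ∀ i : V,
    ∃ f : costdMod K e t →ₗ[A] costdMod K e i, Function.Surjective f

end Modules

/-- The number of arrows `i → j` in the `Ext`-quiver: the dimension of `Ext¹_A(S(i), S(j))`. -/
noncomputable def extArrows (K : Type u) [Field K] {A : Type w} [Ring A] [Algebra K A]
    {V : Type v} (e : V → A) (i j : V) : ℕ :=
  Module.finrank K
    (Abelian.Ext (ModuleCat.of A (simpleMod e i)) (ModuleCat.of A (simpleMod e j)) 1)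

/-! Let `R` be the image of the arrow ideal in `A`. Since `I` lies in the square of the arrow ideal,
the arrows `i → j` give a basis of `e j (R/R²) e i`, so everything reduces to deciding which part of
`e j A e i` lies in `R²`. Let `J i` (`offIdeal`) be the ideal generated by the `e l` with `l ≰ i`;
then `Δ(i) = A e i / J i e i`.

Case `j < i`. The embeddings `Δ(i) → Δ(n) = A e n` send the generators to elements `x i ∈ e i A e n`
such that `a x i = 0` exactly when `a e i ∈ J i`, and `e k A e n` is the line `K x k` because `[Δ(n)
: S(k)] = 1` (`exists_isStdChain`). Hence `e j A e i` modulo `e j (J i) e i` is a line spanned by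
any `u` with `u x i = x j`, and `e j (J i) e i ⊆ R²`. If some `k` lies strictly between, `u` can be
routed through `k` and lies in `R²` (`mem_sq_of_not_covBy`). If `i` covers `j`, then `e j R² x i =
0`: the only vertices a product could pass through are `i` and `j`, and loops in `R` act as zero. So
`u ∉ R²` (`exists_irreducible_of_covBy`).

Case `i < j`. The same argument runs in `Aᵐᵒᵖ`, with a chain `y i ∈ e n A e i` obtained by dualising
`∇(n) → ∇(i)` (`exists_isStdChain_op`). The filtrations of the projectives supply the dimensions:
`(P(k) : Δ(n)) = 1` makes `e n A e k` a line, and `(P(k) : Δ(j)) = 1` shows that `e j A e k` is not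
inside `J j`.

Incomparable case. The kernel of `P(i) → Δ(i)` is filtered by modules `Δ(l)` with `l > i`, so `e j A
e i` consists of sums of products through vertices `l > i`, all different from `i` and `j`; it lies
in `R²` (`idem_mul_mem_aboveIdeal`).

Finally `0 → rad P(i) → P(i) → S(i) → 0` identifies `Ext¹(S(i), S(j))` with `Hom(rad P(i), S(j))`,
on which the arrows `i → j` are coordinates (`extArrows_eq_card`). -/

section Chains

/-! ### Irreducible elements from a chain of standard generators -/

variable {K : Type u} [Field K] {A : Type w} [Ring A] [Algebra K A] {V : Type v}

/-- A complete family of orthogonal idempotents `e` of `A`, with two-sided ideals `R` (the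
radical) and `S = R²`, such that `A = R ⊕ ⨁ K e i`. -/
structure IsRadicalPair [Fintype V] (e : V → A) (R S : Submodule K A) : Prop where
  idem : ∀ i, e i * e i = e i
  orth : ∀ i j, i ≠ j → e i * e j = 0
  complete : ∑ i, e i = 1
  mul_left_mem : ∀ a, ∀ b ∈ R, a * b ∈ R
  mul_right_mem : ∀ a, ∀ b ∈ R, b * a ∈ R
  offdiag_mem : ∀ i j a, i ≠ j → e i * a * e j ∈ R
  idem_notMem : ∀ i, e i ∉ R
  sq_le : S ≤ R
  mul_mem_sq : ∀ a ∈ R, ∀ b ∈ R, a * b ∈ S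
  sq_le_of : ∀ N : Submodule K A, (∀ a ∈ R, ∀ b ∈ R, a * b ∈ N) → S ≤ N

section
variable [PartialOrder V]

variable (K) in
/-- The two-sided ideal generated by the idempotents `e l` with `l ≰ i`. -/
def offIdeal (e : V → A) (i : V) : Submodule K A :=
  Submodule.span K {z | ∃ (l : V) (a b : A), ¬ l ≤ i ∧ z = a * e l * b}

variable (K) in
/-- The two-sided ideal generated by the idempotents `e l` with `i < l`. -/
def aboveIdeal (e : V → A) (i : V) : Submodule K A :=
  Submodule.span K {z | ∃ (l : V) (a b : A), i < l ∧ z = a * e l * b}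

theorem mul_mem_offIdeal {e : V → A} {i l : V} (h : ¬ l ≤ i) (a b : A) :
    a * e l * b ∈ offIdeal K e i :=
  Submodule.subset_span ⟨l, a, b, h, rfl⟩

theorem idem_mul_mem_offIdeal {e : V → A} {i l : V} (h : ¬ l ≤ i) (b : A) :
    e l * b ∈ offIdeal K e i := by
  simpa using mul_mem_offIdeal (K := K) h 1 b

theorem mul_idem_mem_offIdeal {e : V → A} {i l : V} (h : ¬ l ≤ i) (a : A) :
    a * e l ∈ offIdeal K e i := by
  simpa using mul_mem_offIdeal (K := K) h a 1

theorem offIdeal_le {e : V → A} {i : V} {N : Submodule K A}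
    (h : ∀ l a b, ¬ l ≤ i → a * e l * b ∈ N) : offIdeal K e i ≤ N := by
  refine Submodule.span_le.2 ?_
  rintro z ⟨l, a, b, hl, rfl⟩
  exact h l a b hl

theorem mul_mul_mem_offIdeal {e : V → A} {i : V} {z : A} (hz : z ∈ offIdeal K e i) (a b : A) :
    a * z * b ∈ offIdeal K e i := by
  have : offIdeal K e i ≤
      (offIdeal K e i).comap ((LinearMap.mulRight K b).comp (LinearMap.mulLeft K a)) :=
    offIdeal_le fun l c d hl => by
      have := mul_mem_offIdeal (K := K) (e := e) hl (a * c) (d * b)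
      simpa [mul_assoc] using this
  exact this hz

theorem mul_mem_offIdeal_left {e : V → A} {i : V} {z : A} (hz : z ∈ offIdeal K e i) (a : A) :
    a * z ∈ offIdeal K e i := by
  simpa using mul_mul_mem_offIdeal hz a 1

theorem mul_mem_offIdeal_right {e : V → A} {i : V} {z : A} (hz : z ∈ offIdeal K e i) (b : A) :
    z * b ∈ offIdeal K e i := by
  simpa using mul_mul_mem_offIdeal hz 1 b

theorem aboveIdeal_le {e : V → A} {i : V} {N : Submodule K A}
    (h : ∀ l a b, i < l → a * e l * b ∈ N) : aboveIdeal K e i ≤ N := by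
  refine Submodule.span_le.2 ?_
  rintro z ⟨l, a, b, hl, rfl⟩
  exact h l a b hl

theorem mul_mul_mem_aboveIdeal {e : V → A} {i : V} {z : A} (hz : z ∈ aboveIdeal K e i) (a b : A) :
    a * z * b ∈ aboveIdeal K e i := by
  have : aboveIdeal K e i ≤
      (aboveIdeal K e i).comap ((LinearMap.mulRight K b).comp (LinearMap.mulLeft K a)) :=
    aboveIdeal_le fun l c d hl => Submodule.subset_span ⟨l, a * c, d * b, hl, by simp [mul_assoc]⟩
  exact this hz

/-- Elements `x i ∈ e i A` such that `a ↦ a x i` identifies `A e i / A (∑_{l ≰ i} e l) A e i` with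
the span of the `x k`, `k ≤ i`. -/
structure IsStdChain (K : Type u) [Field K] [Algebra K A] (e : V → A) (x : V → A) : Prop where
  idem_mul : ∀ i, e i * x i = x i
  ne_zero : ∀ i, x i ≠ 0
  smul_of_mul : ∀ i k a, ∃ c : K, e k * a * x i = c • x k
  mul_eq_zero_iff : ∀ i a, a * x i = 0 ↔ a * e i ∈ offIdeal K e i
  exists_mul_eq : ∀ i k, k ≤ i → ∃ a, e k * a * x i = x k

variable [Fintype V] {e : V → A} {R S : Submodule K A}

namespace IsRadicalPair

-- Passing through a third vertex splits the product into two off-diagonal factors, each of which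
-- lies in the radical.
omit [PartialOrder V] in
theorem mul_idem_mul_mem (h : IsRadicalPair e R S) {i j l : V} (hi : l ≠ i) (hj : l ≠ j) (a b : A) :
    e j * a * e l * b * e i ∈ S := by
  have := h.mul_mem_sq _ (h.offdiag_mem j l a hj.symm) _ (h.offdiag_mem l i b hi)
  rw [show e j * a * e l * (e l * b * e i) = e j * a * (e l * e l) * b * e i by
    simp only [mul_assoc], h.idem] at this
  exact this

/-- A vertex `l ≰ i` differs from `i`, and also from every `j ≤ i`. -/
theorem mem_sq_of_mem_offIdeal (h : IsRadicalPair e R S) {i j : V} (hji : j ≤ i) {z : A}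
    (hz : z ∈ offIdeal K e i) : e j * z * e i ∈ S := by
  have : offIdeal K e i ≤
      S.comap ((LinearMap.mulRight K (e i)).comp (LinearMap.mulLeft K (e j))) := by
    refine offIdeal_le fun l a b hl => ?_
    have := h.mul_idem_mul_mem (i := i) (j := j) (l := l) (by rintro rfl; exact hl le_rfl)
      (by rintro rfl; exact hl hji) a b
    simpa [mul_assoc] using this
  exact this hz

theorem mem_sq_of_mem_aboveIdeal (h : IsRadicalPair e R S) {i j : V} (hij : ¬ i < j) {z : A}
    (hz : z ∈ aboveIdeal K e i) : e j * z * e i ∈ S := by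
  have : aboveIdeal K e i ≤
      S.comap ((LinearMap.mulRight K (e i)).comp (LinearMap.mulLeft K (e j))) := by
    refine aboveIdeal_le fun l a b hl => ?_
    have := h.mul_idem_mul_mem (i := i) (j := j) (l := l) hl.ne'
      (by rintro rfl; exact hij hl) a b
    simpa [mul_assoc] using this
  exact this hz

omit [PartialOrder V] in
theorem sum_mul (h : IsRadicalPair e R S) (a b : A) : a * b = ∑ l, a * e l * b := by
  rw [← Finset.sum_mul, ← Finset.mul_sum, h.complete, mul_one]

end IsRadicalPair

namespace IsStdChain

variable {x : V → A} (hx : IsStdChain K e x)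
include hx

omit [Fintype V] in
theorem mul_idem_mul (i : V) (a : A) : a * e i * x i = a * x i := by
  rw [mul_assoc, hx.idem_mul]

/-- Both elements send `x i` into the line `K x j`, so some combination annihilates `x i` and hence
lies in `offIdeal`; between `i` and `j ≤ i` this ideal is contained in the radical square. -/
theorem exists_sub_mem (h : IsRadicalPair e R S) {i j : V} (hji : j ≤ i) {u : A}
    (hu : e j * u * x i = x j) (a : A) :
    ∃ c : K, e j * a * e i - c • (e j * u * e i) ∈ offIdeal K e i ∧
      e j * a * e i - c • (e j * u * e i) ∈ S := by
  obtain ⟨c, hc⟩ := hx.smul_of_mul i j a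
  have h0 : (e j * a * e i - c • (e j * u * e i)) * x i = 0 := by
    rw [sub_mul, smul_mul_assoc, hx.mul_idem_mul, hx.mul_idem_mul, hu, hc, sub_self]
  rw [hx.mul_eq_zero_iff] at h0
  have h1 := h.mem_sq_of_mem_offIdeal hji h0
  simp only [mul_sub, sub_mul, mul_smul_comm, smul_mul_assoc] at h0 h1
  simp only [mul_assoc, h.idem] at h0 h1 ⊢
  simp only [← mul_assoc, h.idem] at h0 h1 ⊢
  exact ⟨c, h0, h1⟩

/-- This is the comparison with `u = 1`: a loop is `c • e i` up to the ideal, and `c ≠ 0` would put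
`e i` in the radical. -/
theorem loop_mem (h : IsRadicalPair e R S) (i : V) {a : A} (ha : a ∈ R) :
    e i * a * e i ∈ offIdeal K e i ∧ e i * a * e i ∈ S := by
  have h1 : e i * 1 * x i = x i := by rw [mul_one, hx.idem_mul]
  obtain ⟨c, hc, hc'⟩ := hx.exists_sub_mem h le_rfl h1 a
  rw [mul_one, h.idem] at hc hc'
  have h2 : c • e i ∈ R := by
    have := R.sub_mem (h.mul_right_mem (e i) _ (h.mul_left_mem (e i) _ ha)) (h.sq_le hc')
    simpa using this
  have h3 : c = 0 := by
    by_contra hne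
    exact h.idem_notMem i ((R.smul_mem_iff hne).1 h2)
  simpa [h3] using And.intro hc hc'

/-- Insert `1 = ∑ e l` between the two radical factors. A vertex `l ≰ i` is killed by `x i`, and `l
= i` gives a loop at `i`. If `l < i`, the right factor lands in `K x l`, and the covering relation
leaves only `l = j`, a loop at `j`, or `j ≰ l`, where the left factor kills `x l`. -/
theorem mul_mul_eq_zero_of_covBy (h : IsRadicalPair e R S) {i j : V} (hji : j ⋖ i) {z : A}
    (hz : z ∈ S) : e j * z * x i = 0 := by
  have key : S ≤ LinearMap.ker
      ((LinearMap.mulRight K (x i)).comp (LinearMap.mulLeft K (e j))) := by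
    refine h.sq_le_of _ fun a ha b hb => ?_
    have hl : ∀ l, e j * a * e l * (e l * b * x i) = 0 := by
      intro l
      by_cases hli : l ≤ i
      · rcases eq_or_ne l i with rfl | hne
        · rw [← hx.mul_idem_mul l (e l * b), (hx.mul_eq_zero_iff l (e l * b * e l)).2, mul_zero]
          rw [mul_assoc _ (e l) (e l), h.idem]
          exact (hx.loop_mem h l hb).1
        · obtain ⟨c, hc⟩ := hx.smul_of_mul i l b
          rw [hc, mul_smul_comm, hx.mul_idem_mul, (hx.mul_eq_zero_iff l (e j * a)).2, smul_zero]
          by_cases hjl : j ≤ l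
          · have : l = j := by
              by_contra hlj
              exact hji.2 (lt_of_le_of_ne hjl (Ne.symm hlj)) (lt_of_le_of_ne hli hne)
            subst this
            exact (hx.loop_mem h l ha).1
          · have := mul_mem_offIdeal (K := K) (e := e) hjl 1 (a * e l)
            simpa [mul_assoc] using this
      · rw [(hx.mul_eq_zero_iff i (e l * b)).2, mul_zero]
        have := mul_mem_offIdeal (K := K) (e := e) hli 1 (b * e i)
        simpa [mul_assoc] using this
    have : e j * a * (b * x i) = 0 := by
      rw [h.sum_mul (e j * a) (b * x i)]
      refine Finset.sum_eq_zero fun l _ => ?_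
      have := hl l
      rw [show e j * a * e l * (e l * b * x i) = e j * a * (e l * e l) * (b * x i) by
        simp only [mul_assoc], h.idem] at this
      exact this
    simpa [mul_assoc] using this
  simpa using key hz

/-- Below `i`, there is exactly one irreducible element from `i` to a neighbour of `i`. -/
theorem exists_irreducible_of_covBy (h : IsRadicalPair e R S) {i j : V} (hji : j ⋖ i) :
    ∃ u, e j * u * e i ∉ S ∧ ∀ a, ∃ c : K, e j * a * e i - c • (e j * u * e i) ∈ S := by
  obtain ⟨u, hu⟩ := hx.exists_mul_eq i j hji.1.le
  refine ⟨u, fun hS => ?_, fun a => ?_⟩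
  · have := hx.mul_mul_eq_zero_of_covBy h hji hS
    rw [show e j * (e j * u * e i) * x i = (e j * e j) * u * e i * x i by simp only [mul_assoc],
      h.idem, hx.mul_idem_mul, hu] at this
    exact hx.ne_zero j this
  · obtain ⟨c, -, hc⟩ := hx.exists_sub_mem h hji.1.le hu a
    exact ⟨c, hc⟩

/-- With `j < k < i`, an element carrying `x i` to `x j` can be composed from one carrying `x i` to
`x k` and one carrying `x k` to `x j`; every other element of `e j A e i` is a multiple of it modulo
`S`. -/
theorem mem_sq_of_not_covBy (h : IsRadicalPair e R S) {i j : V} (hji : j < i) (hc : ¬ j ⋖ i)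
    (a : A) : e j * a * e i ∈ S := by
  obtain ⟨k, hjk, hki⟩ := (not_covBy_iff hji).1 hc
  obtain ⟨b, hb⟩ := hx.exists_mul_eq i k hki.le
  obtain ⟨d, hd⟩ := hx.exists_mul_eq k j hjk.le
  have hu : e j * (d * e k * b) * x i = x j := by
    rw [← hd, ← hb]
    simp only [mul_assoc]
  obtain ⟨c, -, hc⟩ := hx.exists_sub_mem h hji.le hu a
  have h1 : e j * (d * e k * b) * e i ∈ S := by
    have := h.mul_idem_mul_mem (i := i) (j := j) (l := k) hki.ne hjk.ne' d b
    simpa [mul_assoc] using this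
  simpa using S.add_mem hc (S.smul_mem c h1)

end IsStdChain

/-! ### Passage to the opposite algebra -/

section Opposite

open MulOpposite

/-- The transport of a subspace of `A` to the opposite algebra. -/
def opSubmodule (N : Submodule K A) : Submodule K Aᵐᵒᵖ :=
  N.comap (opLinearEquiv K).symm.toLinearMap

theorem op_mem_opSubmodule {N : Submodule K A} {a : A} : op a ∈ opSubmodule N ↔ a ∈ N :=
  Iff.rfl

omit [Fintype V] in
theorem opSubmodule_offIdeal (i : V) :
    offIdeal K (fun k => op (e k)) i = opSubmodule (offIdeal K e i) := by
  apply le_antisymm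
  · refine offIdeal_le fun l a b hl => ?_
    have := mul_mem_offIdeal (K := K) (e := e) hl b.unop a.unop
    rw [← op_mem_opSubmodule] at this
    simpa [mul_assoc] using this
  · have : offIdeal K e i ≤
        (offIdeal K (fun k => op (e k)) i).comap (opLinearEquiv K).toLinearMap := by
      refine offIdeal_le fun l a b hl => ?_
      have := mul_mem_offIdeal (K := K) (e := fun k => op (e k)) hl (op b) (op a)
      simpa [mul_assoc] using this
    intro z hz
    exact this hz

omit [PartialOrder V] in
theorem IsRadicalPair.op (h : IsRadicalPair e R S) :
    IsRadicalPair (fun k => op (e k)) (opSubmodule R) (opSubmodule S) where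
  idem i := by rw [← op_mul, h.idem]
  orth i j hij := by rw [← op_mul, h.orth j i hij.symm, op_zero]
  complete := by
    have := congrArg (opLinearEquiv K) h.complete
    simpa using this
  mul_left_mem a b hb := h.mul_right_mem a.unop b.unop hb
  mul_right_mem a b hb := h.mul_left_mem a.unop b.unop hb
  offdiag_mem i j a hij := by
    have := h.offdiag_mem j i a.unop hij.symm
    rw [← op_mem_opSubmodule] at this
    simpa [mul_assoc] using this
  idem_notMem i := h.idem_notMem i
  sq_le z hz := h.sq_le hz
  mul_mem_sq a ha b hb := h.mul_mem_sq b.unop hb a.unop ha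
  sq_le_of N hN z hz := h.sq_le_of (N.comap (opLinearEquiv K).toLinearMap)
    (fun a ha b hb => hN (MulOpposite.op b) hb (MulOpposite.op a) ha) hz

end Opposite

end

end Chains

/-! ### Neighbours and non-neighbours -/

section Alternative

variable {K : Type u} [Field K] {A : Type w} [Ring A] [Algebra K A] {V : Type v} [PartialOrder V]
  [Fintype V] {e : V → A} {R S : Submodule K A} {x : V → A} {y : V → Aᵐᵒᵖ}

theorem IsRadicalPair.exists_irreducible_of_neighbours (h : IsRadicalPair e R S)
    (hx : IsStdChain K e x) (hy : IsStdChain K (fun k => MulOpposite.op (e k)) y) {i j : V}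
    (hij : i ⋖ j ∨ j ⋖ i) :
    ∃ u, e j * u * e i ∉ S ∧ ∀ a, ∃ c : K, e j * a * e i - c • (e j * u * e i) ∈ S := by
  rcases hij with hij | hji
  -- Taking opposites reverses `e j * a * e i`, so the downward statement for `y` is the upward one
  -- for `A`.
  · obtain ⟨u, hu, hu'⟩ := hy.exists_irreducible_of_covBy h.op hij
    refine ⟨u.unop, fun hS => hu ?_, fun a => ?_⟩
    · rw [← op_mem_opSubmodule] at hS
      simpa [mul_assoc] using hS
    · obtain ⟨c, hc⟩ := hu' (MulOpposite.op a)
      refine ⟨c, ?_⟩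
      rw [← op_mem_opSubmodule]
      simpa [mul_assoc] using hc
  · exact hx.exists_irreducible_of_covBy h hji

theorem IsRadicalPair.mem_sq_of_not_neighbours (h : IsRadicalPair e R S)
    (hx : IsStdChain K e x) (hy : IsStdChain K (fun k => MulOpposite.op (e k)) y)
    (habove : ∀ i l a, ¬ l ≤ i → e l * a * e i ∈ aboveIdeal K e i) {i j : V}
    (hij : ¬ (i ⋖ j ∨ j ⋖ i)) {a : A} (ha : a ∈ R) : e j * a * e i ∈ S := by
  rw [not_or] at hij
  by_cases hji : j ≤ i
  · rcases hji.eq_or_lt with rfl | hlt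
    · exact (hx.loop_mem h j ha).2
    · exact hx.mem_sq_of_not_covBy h hlt hij.2 a
  · by_cases hlt : i < j
    · have := hy.mem_sq_of_not_covBy h.op hlt hij.1 (MulOpposite.op a)
      rw [← op_mem_opSubmodule]
      simpa [mul_assoc] using this
    -- The vertices are incomparable: the element passes through vertices above `i`, none of which
    -- is `j`.
    · have := h.mem_sq_of_mem_aboveIdeal hlt (habove i j a hji)
      rwa [← mul_assoc, ← mul_assoc, h.idem, mul_assoc _ (e i), h.idem] at this

end Alternative

/-! ### Standard modules and the chain in `P(n)` -/

section Std

variable {K : Type u} [Field K] {A : Type w} [Ring A] [Algebra K A] {V : Type v} {e : V → A}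

theorem jhMult_eq_zero_iff {M : Type x} [AddCommGroup M] [Module K M] [Module A M]
    [IsScalarTower K A M] [FiniteDimensional K M] {i : V} :
    jhMult K e M i = 0 ↔ ∀ m : M, e i • m = 0 := by
  rw [jhMult, Submodule.finrank_eq_zero, LinearMap.range_eq_bot]
  exact ⟨fun h m => congrArg (fun f => f m) h, fun h => LinearMap.ext h⟩

theorem exists_eq_smul_of_jhMult_eq_one {M : Type x} [AddCommGroup M] [Module K M] [Module A M]
    [IsScalarTower K A M] {i : V} (hM : jhMult K e M i = 1) {v : M} (hv : e i • v ≠ 0) (m : M) :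
    ∃ c : K, e i • m = c • e i • v := by
  let v' : LinearMap.range (Algebra.lsmul K K M (e i)) := ⟨e i • v, v, rfl⟩
  have hv' : v' ≠ 0 := fun h => hv (congrArg Subtype.val h)
  obtain ⟨c, hc⟩ := (finrank_eq_one_iff_of_nonzero' v' hv').1 hM ⟨e i • m, m, rfl⟩
  exact ⟨c, (congrArg Subtype.val hc).symm⟩

/-- The generator `e i` of `P(i)`. -/
def projGen (e : V → A) (i : V) : projMod e i := ⟨e i, Submodule.mem_span_singleton_self _⟩

theorem exists_smul_projGen {i : V} (z : projMod e i) : ∃ a : A, z = a • projGen e i := by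
  obtain ⟨a, ha⟩ := Submodule.mem_span_singleton.1 z.2
  exact ⟨a, Subtype.ext ha.symm⟩

theorem coe_mul_idem (he : ∀ i, e i * e i = e i) {i : V} (z : projMod e i) :
    (z : A) * e i = z := by
  obtain ⟨a, rfl⟩ := exists_smul_projGen z
  simp [projGen, mul_assoc, he]

theorem coe_smul_projGen (he : ∀ i, e i * e i = e i) {i : V} (z : projMod e i) :
    (z : A) • projGen e i = z :=
  Subtype.ext (coe_mul_idem he z)

instance projMod_finite [FiniteDimensional K A] (i : V) : FiniteDimensional K (projMod e i) :=
  inferInstanceAs (FiniteDimensional K ((projMod e i).restrictScalars K))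

instance quotient_finite {M : Type x} [AddCommGroup M] [Module K M] [Module A M]
    [IsScalarTower K A M] [FiniteDimensional K M] (N : Submodule A M) :
    FiniteDimensional K (M ⧸ N) :=
  Module.Finite.of_surjective (N.mkQ.restrictScalars K) N.mkQ_surjective

variable [PartialOrder V] [FiniteDimensional K A]

/-- The trace in `P(i)` of the idempotents `e l`, `l ≰ i`, is the smallest submodule whose quotient
they annihilate. This turns questions about `Δ(i)` into membership in a two-sided ideal. -/
theorem mem_stdKer_iff (he : ∀ i, e i * e i = e i) {i : V} {z : projMod e i} :
    z ∈ stdKer K e i ↔ (z : A) ∈ offIdeal K e i := by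
  constructor
  · intro hz
    let N : Submodule A (projMod e i) :=
      { carrier := {z | (z : A) ∈ offIdeal K e i}
        add_mem' := fun ha hb => (offIdeal K e i).add_mem ha hb
        zero_mem' := (offIdeal K e i).zero_mem
        smul_mem' := fun a z hz => mul_mem_offIdeal_left hz a }
    have hN : stdKer K e i ≤ N := by
      refine sInf_le fun j hj => ?_
      rw [jhMult_eq_zero_iff]
      intro m
      obtain ⟨m, rfl⟩ := N.mkQ_surjective m
      rw [← map_smul, Submodule.mkQ_apply, Submodule.Quotient.mk_eq_zero]
      exact idem_mul_mem_offIdeal hj _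
    exact hN hz
  · intro hz
    refine (Submodule.mem_sInf).2 fun N hN => ?_
    let f : A →ₗ[K] projMod e i := (LinearMap.toSpanSingleton A _ (projGen e i)).restrictScalars K
    have key : offIdeal K e i ≤ (N.restrictScalars K).comap f := by
      refine offIdeal_le fun l a b hl => ?_
      have h1 := jhMult_eq_zero_iff.1 (hN l hl) (N.mkQ (b • projGen e i))
      rw [← map_smul, Submodule.mkQ_apply, Submodule.Quotient.mk_eq_zero] at h1
      have := N.smul_mem a h1
      rw [← mul_smul, ← mul_smul] at this
      exact this
    have := key hz
    change (z : A) • projGen e i ∈ N at this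
    rwa [coe_smul_projGen he] at this

/-- The generator of `Δ(i)`. -/
noncomputable def stdGen (K : Type u) [Field K] [Algebra K A] (e : V → A) (i : V) : stdMod K e i :=
  (stdKer K e i).mkQ (projGen e i)

omit [FiniteDimensional K A] in
theorem exists_smul_stdGen {i : V} (z : stdMod K e i) : ∃ a : A, z = a • stdGen K e i := by
  obtain ⟨z, rfl⟩ := (stdKer K e i).mkQ_surjective z
  obtain ⟨a, rfl⟩ := exists_smul_projGen z
  exact ⟨a, map_smul _ _ _⟩

theorem smul_stdGen_eq_zero_iff (he : ∀ i, e i * e i = e i) {i : V} {a : A} :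
    a • stdGen K e i = 0 ↔ a * e i ∈ offIdeal K e i := by
  rw [stdGen, ← map_smul, Submodule.mkQ_apply, Submodule.Quotient.mk_eq_zero, mem_stdKer_iff he]
  rfl

omit [FiniteDimensional K A] in
theorem idem_smul_stdGen (he : ∀ i, e i * e i = e i) (i : V) :
    e i • stdGen K e i = stdGen K e i := by
  rw [stdGen, ← map_smul]
  exact congrArg _ (Subtype.ext (he i))

theorem IsOneQuasiHereditary.idem_notMem (he : ∀ i, e i * e i = e i)
    (hA : IsOneQuasiHereditary K e) (i : V) : e i ∉ offIdeal K e i := by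
  intro h
  have h0 : stdGen K e i = 0 := by
    rw [← one_smul A (stdGen K e i), smul_stdGen_eq_zero_iff he, one_mul]
    exact h
  have : jhMult K e (stdMod K e i) i = 0 := by
    rw [jhMult_eq_zero_iff]
    intro z
    obtain ⟨a, rfl⟩ := exists_smul_stdGen z
    rw [h0, smul_zero, smul_zero]
  rw [hA.std_self] at this
  exact one_ne_zero this

/-- The embeddings `Δ(i) → Δ(n)` give a chain of generators in `P(n) = A e n`. -/
theorem IsOneQuasiHereditary.exists_isStdChain (he : ∀ i, e i * e i = e i)
    (hA : IsOneQuasiHereditary K e) : ∃ x, IsStdChain K e x := by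
  obtain ⟨t, ht⟩ := hA.exists_greatest
  choose f hf using hA.std_embeds t ht
  -- No vertex is excluded at the largest element, so `Δ(t) = P(t)` and vanishing in `Δ(t)` is
  -- vanishing in `A`.
  have hoff : offIdeal K e t = ⊥ :=
    le_bot_iff.1 (offIdeal_le fun l a b hl => absurd (ht l) hl)
  choose p hp using fun i => (stdKer K e t).mkQ_surjective (f i (stdGen K e i))
  have hzero : ∀ z : projMod e t, (stdKer K e t).mkQ z = 0 ↔ (z : A) = 0 := fun z => by
    rw [Submodule.mkQ_apply, Submodule.Quotient.mk_eq_zero, mem_stdKer_iff he, hoff,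
      Submodule.mem_bot]
  have hxp : ∀ i a, f i (a • stdGen K e i) = (stdKer K e t).mkQ (a • p i) := fun i a => by
    rw [map_smul, map_smul, hp]
  have hannih : ∀ i (a : A), a * (p i : A) = 0 ↔ a * e i ∈ offIdeal K e i := fun i a => by
    rw [← smul_stdGen_eq_zero_iff he, ← map_eq_zero_iff _ (hf i), hxp, hzero]
    rfl
  have hidem : ∀ i, e i * p i = (p i : A) := fun i => by
    have := (hzero (e i • p i - p i)).1
      (by rw [map_sub, ← hxp, idem_smul_stdGen he, hp, sub_self])
    exact sub_eq_zero.1 this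
  have hne : ∀ i, (p i : A) ≠ 0 := fun i h => by
    have := (hannih i 1).1 (by rw [one_mul, h])
    rw [one_mul] at this
    exact hA.idem_notMem he i this
  -- `[Δ(t) : S(k)] = 1`, and the nonzero element `p k = e k * p k` spans the line `e k Δ(t)`.
  have hrank : ∀ i k (a : A), ∃ c : K, e k * a * (p i : A) = c • (p k : A) := fun i k a => by
    have h1 : e k • (stdKer K e t).mkQ (p k) ≠ 0 := by
      rw [← map_smul, ne_eq, hzero]
      change e k * (p k : A) ≠ 0
      rw [hidem]
      exact hne k
    obtain ⟨c, hc⟩ := exists_eq_smul_of_jhMult_eq_one (hA.std_mult t k (ht k)) h1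
      ((stdKer K e t).mkQ (a • p i))
    refine ⟨c, ?_⟩
    have h2 : (stdKer K e t).mkQ (e k • a • p i - c • e k • p k) = 0 := by
      rw [map_sub, sub_eq_zero, map_smul, hc, ← map_smul]
      exact (((stdKer K e t).mkQ.restrictScalars K).map_smul c _).symm
    rw [hzero] at h2
    have h3 : e k * (a * p i) - c • (e k * p k) = 0 := h2
    rwa [hidem, sub_eq_zero, ← mul_assoc] at h3
  refine ⟨fun i => p i, hidem, hne, hrank, hannih, fun i k hki => ?_⟩
  have h1 : ¬ ∀ z : stdMod K e i, e k • z = 0 := by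
    rw [← jhMult_eq_zero_iff (K := K), hA.std_mult i k hki]
    exact one_ne_zero
  push Not at h1
  obtain ⟨z, hz⟩ := h1
  obtain ⟨a, rfl⟩ := exists_smul_stdGen z
  obtain ⟨c, hc⟩ := hrank i k a
  have hc0 : c ≠ 0 := by
    rintro rfl
    rw [zero_smul, hannih] at hc
    rw [← mul_smul, ne_eq, smul_stdGen_eq_zero_iff he] at hz
    exact hz hc
  refine ⟨c⁻¹ • a, ?_⟩
  rw [mul_smul_comm, smul_mul_assoc, hc, smul_smul, inv_mul_cancel₀ hc0, one_smul]

end Std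

/-! ### Consequences of the `Δ`-good filtrations of the projectives -/

section Filtrations

variable {K : Type u} [Field K] {A : Type w} [Ring A] [Algebra K A] {V : Type v} {e : V → A}
  [PartialOrder V]

/-- `w` induces an isomorphism from `Δ(i)` to `N' / N`. -/
structure IsStdStep (K : Type u) [Field K] [Algebra K A] (e : V → A) {M : Type x} [AddCommGroup M]
    [Module A M] (N N' : Submodule A M) (i : V) (w : M) : Prop where
  le : N ≤ N'
  mem : w ∈ N'
  idem_smul : e i • w = w
  exists_sub_mem : ∀ z ∈ N', ∃ a : A, z - a • w ∈ N
  smul_mem_iff : ∀ a : A, a • w ∈ N ↔ a * e i ∈ offIdeal K e i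

theorem StdFiltration.exists_isStdStep [FiniteDimensional K A] (he : ∀ i, e i * e i = e i)
    {M : Type x} [AddCommGroup M] [Module A M] (F : StdFiltration K e M) (k : Fin F.len) :
    ∃ w, IsStdStep K e (F.sub k.castSucc) (F.sub k.succ) (F.label k) w := by
  obtain ⟨f⟩ := F.iso k
  set N := F.sub k.castSucc
  set N' := F.sub k.succ
  set i := F.label k
  obtain ⟨w, hw⟩ := (N.comap N'.subtype).mkQ_surjective (f.symm (stdGen K e i))
  have hN : N ≤ N' := F.mono k.castSucc_lt_succ.le
  have hmk : ∀ a : A, f ((N.comap N'.subtype).mkQ (a • w)) = a • stdGen K e i := fun a => by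
    rw [map_smul, map_smul, hw, LinearEquiv.apply_symm_apply]
  have hmem : ∀ a : A, a • (w : M) ∈ N ↔ a * e i ∈ offIdeal K e i := fun a => by
    rw [← smul_stdGen_eq_zero_iff he, ← hmk, LinearEquiv.map_eq_zero_iff, Submodule.mkQ_apply,
      Submodule.Quotient.mk_eq_zero]
    rfl
  have hidem : e i • e i • (w : M) = e i • (w : M) := by rw [← mul_smul, he]
  have hsub : ∀ z ∈ N', ∃ a : A, z - a • e i • (w : M) ∈ N := fun z hz => by
    obtain ⟨a, ha⟩ := exists_smul_stdGen (f ((N.comap N'.subtype).mkQ ⟨z, hz⟩))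
    refine ⟨a, ?_⟩
    have h1 : f ((N.comap N'.subtype).mkQ (⟨z, hz⟩ - a • e i • w)) = 0 := by
      rw [map_sub, map_sub, ha, ← mul_smul, hmk, mul_smul, idem_smul_stdGen he, sub_self]
    rw [LinearEquiv.map_eq_zero_iff, Submodule.mkQ_apply, Submodule.Quotient.mk_eq_zero] at h1
    exact h1
  -- A lift `w` of the generator need not be fixed by `e i`; `e i • w` is another lift, and it is.
  refine ⟨e i • (w : M), hN, N'.smul_mem _ w.2, hidem, hsub, fun a => ?_⟩
  rw [← mul_smul, hmem, mul_assoc, he]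

namespace IsStdStep

variable {M : Type x} [AddCommGroup M] [Module A M] {N N' : Submodule A M} {i : V} {w : M}

theorem idem_smul_mem (h : IsStdStep K e N N' i w) {l : V} (hl : ¬ l ≤ i) {z : M} (hz : z ∈ N') :
    e l • z ∈ N := by
  obtain ⟨a, ha⟩ := h.exists_sub_mem z hz
  have h1 : (e l * a) • w ∈ N := by
    rw [h.smul_mem_iff, mul_assoc]
    exact idem_mul_mem_offIdeal hl _
  have h2 := N.add_mem (N.smul_mem (e l) ha) h1
  rwa [smul_sub, mul_smul, sub_add_cancel] at h2

theorem exists_idem_smul_sub_mem [FiniteDimensional K A] (he : ∀ i, e i * e i = e i)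
    [Module K M] [IsScalarTower K A M] (h : IsStdStep K e N N' i w)
    (hi : jhMult K e (stdMod K e i) i = 1) (hne : e i ∉ offIdeal K e i) {z : M} (hz : z ∈ N') :
    ∃ c : K, e i • z - c • w ∈ N := by
  obtain ⟨a, ha⟩ := h.exists_sub_mem z hz
  have h1 : e i • stdGen K e i ≠ 0 := by
    rwa [ne_eq, smul_stdGen_eq_zero_iff he, he]
  obtain ⟨c, hc⟩ := exists_eq_smul_of_jhMult_eq_one hi h1 (a • stdGen K e i)
  have h2 : (e i * a - c • e i) • w ∈ N := by
    rw [h.smul_mem_iff, ← smul_stdGen_eq_zero_iff he, sub_smul, mul_smul, hc, smul_assoc, sub_self]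
  refine ⟨c, ?_⟩
  have h3 := N.add_mem (N.smul_mem (e i) ha) h2
  rwa [sub_smul, smul_assoc, h.idem_smul, smul_sub, mul_smul, sub_add_sub_cancel] at h3

end IsStdStep

/-- The submodule generated by all `e l N` with `l ≰ j`. -/
def offTrace (e : V → A) (j : V) {M : Type x} [AddCommGroup M] [Module A M] (N : Submodule A M) :
    Submodule A M :=
  Submodule.span A {z | ∃ (l : V) (m : M), ¬ l ≤ j ∧ m ∈ N ∧ z = e l • m}

theorem offTrace_le {j : V} {M : Type x} [AddCommGroup M] [Module A M] {N L : Submodule A M}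
    (h : ∀ l, ¬ l ≤ j → ∀ m ∈ N, e l • m ∈ L) : offTrace e j N ≤ L := by
  refine Submodule.span_le.2 ?_
  rintro z ⟨l, m, hl, hm, rfl⟩
  exact h l hl m hm

theorem idem_smul_mem_offTrace {j l : V} {M : Type x} [AddCommGroup M] [Module A M]
    {N : Submodule A M} (hl : ¬ l ≤ j) {m : M} (hm : m ∈ N) : e l • m ∈ offTrace e j N :=
  Submodule.subset_span ⟨l, m, hl, hm, rfl⟩

/-- An intersection property: `N ∩ offTrace e j N' ⊆ offTrace e j N`. It lets non-membership in the
trace climb a filtration. If `i ≤ j`, the step `Δ(i)` contributes nothing to the trace. Otherwise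
the new contribution is `A w`, and the part of it inside `N` comes from `aboveIdeal`, hence from
vertices `l > i`, which satisfy `l ≰ j` and map `N'` into `N`. -/
theorem IsStdStep.mem_offTrace (he : ∀ i, e i * e i = e i)
    (habove : ∀ i, ∀ z ∈ offIdeal K e i, z * e i ∈ aboveIdeal K e i)
    {M : Type x} [AddCommGroup M] [Module K M] [Module A M] [IsScalarTower K A M]
    {N N' : Submodule A M} {i j : V} {w : M} (h : IsStdStep K e N N' i w) {z : M} (hz : z ∈ N)
    (hz' : z ∈ offTrace e j N') : z ∈ offTrace e j N := by
  by_cases hij : i ≤ j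
  · refine offTrace_le (fun l hl m hm => ?_) hz'
    have := idem_smul_mem_offTrace (e := e) hl (h.idem_smul_mem (fun hli => hl (hli.trans hij)) hm)
    rwa [← mul_smul, he] at this
  · have hle : offTrace e j N ≤ N := offTrace_le fun l _ m hm => N.smul_mem _ hm
    have h1 : offTrace e j N' ≤ offTrace e j N ⊔ Submodule.span A {w} := by
      refine offTrace_le fun l hl m hm => ?_
      obtain ⟨a, ha⟩ := h.exists_sub_mem m hm
      have h2 := Submodule.add_mem_sup (idem_smul_mem_offTrace (e := e) hl ha)
        (Submodule.mem_span_singleton.2 ⟨e l * a, rfl⟩ : (e l * a) • w ∈ Submodule.span A {w})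
      rwa [smul_sub, mul_smul, sub_add_cancel] at h2
    obtain ⟨y, hy, t, ht, rfl⟩ := Submodule.mem_sup.1 (h1 hz')
    obtain ⟨a, rfl⟩ := Submodule.mem_span_singleton.1 ht
    refine Submodule.add_mem _ hy ?_
    have h3 : a • w ∈ N := (N.add_mem_iff_right (hle hy)).1 hz
    rw [h.smul_mem_iff] at h3
    have h4 := habove i _ h3
    rw [mul_assoc, he] at h4
    have key : aboveIdeal K e i ≤ ((offTrace e j N).restrictScalars K).comap
        ((LinearMap.toSpanSingleton A M w).restrictScalars K) := by
      refine aboveIdeal_le fun l b d hil => ?_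
      have h5 := idem_smul_mem_offTrace (e := e) (l := l) (j := j)
        (fun hlj => hij (hil.le.trans hlj))
        (h.idem_smul_mem (l := l) hil.not_ge (N'.smul_mem d h.mem))
      have h6 := Submodule.smul_mem _ b h5
      rw [← mul_smul, ← mul_smul, ← mul_smul, mul_assoc b, he] at h6
      exact h6
    have h7 : (a * e i) • w ∈ offTrace e j N := key h4
    rwa [mul_smul, h.idem_smul] at h7

theorem StdFiltration.mult_ne_zero {M : Type x} [AddCommGroup M] [Module A M]
    (F : StdFiltration K e M) (k : Fin F.len) : F.mult (F.label k) ≠ 0 := by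
  rw [mult, Nat.card_ne_zero]
  exact ⟨⟨k, rfl⟩, inferInstance⟩

theorem StdFiltration.exists_unique_label {M : Type x} [AddCommGroup M] [Module A M]
    (F : StdFiltration K e M) {i : V} (h : F.mult i = 1) :
    ∃ k, F.label k = i ∧ ∀ s, F.label s = i → s = k := by
  obtain ⟨h1, ⟨k, hk⟩⟩ := Nat.card_eq_one_iff_unique.1 h
  exact ⟨k, hk, fun s hs => congrArg Subtype.val
    (Subsingleton.elim (⟨s, hs⟩ : {k // F.label k = i}) ⟨k, hk⟩)⟩

variable [FiniteDimensional K A] (he : ∀ i, e i * e i = e i)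
include he

/-- Since `e l` annihilates `Δ(s)` unless `l ≤ s`, it moves elements down through every step with
such a label; idempotency lets one factor `e l` serve all steps. -/
theorem StdFiltration.idem_smul_mem {M : Type x} [AddCommGroup M] [Module A M]
    (F : StdFiltration K e M) {l : V} (a : Fin (F.len + 1)) (b : Fin (F.len + 1)) (hab : a ≤ b)
    (h : ∀ s : Fin F.len, a ≤ s.castSucc → s.succ ≤ b → ¬ l ≤ F.label s) :
    ∀ z ∈ F.sub b, e l • z ∈ F.sub a := by
  induction b using Fin.induction with
  | zero =>
    obtain rfl : a = 0 := le_antisymm hab (Fin.zero_le _)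
    exact fun z hz => Submodule.smul_mem _ _ hz
  | succ s ih =>
    intro z hz
    rcases hab.eq_or_lt with rfl | hlt
    · exact Submodule.smul_mem _ _ hz
    · have has : a ≤ s.castSucc := Fin.le_castSucc_iff.2 hlt
      obtain ⟨w, hw⟩ := F.exists_isStdStep he s
      have h1 := hw.idem_smul_mem (h s has le_rfl) hz
      have h2 := ih has (fun s' h1 h2 => h s' h1 (h2.trans s.castSucc_lt_succ.le)) _ h1
      rwa [← mul_smul, he] at h2

variable (hA : IsOneQuasiHereditary K e)
include hA

/-- The unique factor `Δ(i)` of the filtration of `P(i)` sits on top, and all lower factors are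
`Δ(l)` with `l > i`, so what lies below the top step is generated by elements of the form `e l * v`.
For `l ≰ i`, `e l` annihilates the top factor. -/
theorem IsOneQuasiHereditary.idem_mul_mem_aboveIdeal {i l : V} (hl : ¬ l ≤ i) (a : A) :
    e l * a * e i ∈ aboveIdeal K e i := by
  obtain ⟨x, hx⟩ := hA.exists_isStdChain he
  obtain ⟨F, hF0, hF1⟩ := hA.proj_good i
  obtain ⟨k, hk, huniq⟩ := F.exists_unique_label hF1
  have hle : ∀ s, i ≤ F.label s := fun s => by
    by_contra hs
    exact F.mult_ne_zero s (hF0 _ hs)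
  have hlen : 0 < F.len := k.pos
  let r : Fin F.len := ⟨F.len - 1, by omega⟩
  have hr : r.succ = Fin.last F.len := by ext; simp [r]; omega
  obtain ⟨w, hw⟩ := F.exists_isStdStep he r
  rw [hr, F.sub_last] at hw
  have hri : F.label r = i := by
    refine le_antisymm ?_ (hle r)
    -- If the top label `l` were not `i`, then `e i ≡ b w` modulo the lower step would give `w ≡ w b
    -- w`, hence `x l = w b x l`. But `w = w e i` and `e i b x l ∈ K x i`, while `w x i = 0` because
    -- `w = e l w` with `l ≰ i`; so `x l = 0`.
    by_contra hn
    obtain ⟨b, hb⟩ := hw.exists_sub_mem (projGen e i) trivial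
    have h1 : (1 - w * b : A) • w ∈ F.sub r.castSucc := by
      have h2 := Submodule.smul_mem _ (w : A) hb
      rw [smul_sub, coe_smul_projGen he, ← mul_smul] at h2
      rwa [sub_smul, one_smul]
    rw [hw.smul_mem_iff, ← hx.mul_eq_zero_iff, sub_mul, one_mul, sub_eq_zero] at h1
    obtain ⟨c, hc⟩ := hx.smul_of_mul (F.label r) i b
    have hwl : e (F.label r) * w = (w : A) := congrArg Subtype.val hw.idem_smul
    have h3 : (w : A) * x i = 0 := by
      rw [hx.mul_eq_zero_iff, ← hwl, mul_assoc]
      exact idem_mul_mem_offIdeal hn _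
    rw [← coe_mul_idem he w, mul_assoc _ (e i), mul_assoc, hc, mul_smul_comm, h3, smul_zero] at h1
    exact hx.ne_zero _ h1
  have hlt : ∀ s, s ≠ r → i < F.label s := fun s hs =>
    lt_of_le_of_ne (hle s) fun h => hs ((huniq s h.symm).trans (huniq r hri).symm)
  have hsub : ∀ t, t ≤ r.castSucc → ∀ z ∈ F.sub t, (z : A) ∈ aboveIdeal K e i := by
    intro t
    induction t using Fin.induction with
    | zero =>
      intro _ z hz
      rw [F.sub_zero, Submodule.mem_bot] at hz
      rw [hz]
      exact Submodule.zero_mem _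
    | succ s ih =>
      intro hs z hz
      have hsr : s < r := Fin.succ_le_castSucc_iff.1 hs
      obtain ⟨v, hv⟩ := F.exists_isStdStep he s
      obtain ⟨b, hb⟩ := hv.exists_sub_mem z hz
      have h1 := ih (s.castSucc_lt_succ.le.trans hs) _ hb
      have h2 : b * e (F.label s) * (v : A) ∈ aboveIdeal K e i :=
        Submodule.subset_span ⟨_, b, v, hlt s hsr.ne, rfl⟩
      have h3 : b * e (F.label s) * (v : A) = b * v := by
        rw [mul_assoc]
        exact congrArg (b * ·) (congrArg Subtype.val hv.idem_smul)
      have h4 := Submodule.add_mem _ h1 h2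
      rw [h3] at h4
      have h5 : ((z - b • v : projMod e i) : A) + b * v = z := sub_add_cancel (z : A) (b * v)
      rwa [h5] at h4
  rw [hri] at hw
  have h1 := hsub _ le_rfl _ (hw.idem_smul_mem hl (z := a • projGen e i) trivial)
  have h2 : ((e l • a • projGen e i : projMod e i) : A) = e l * a * e i := (mul_assoc _ _ _).symm
  rwa [h2] at h1

theorem IsOneQuasiHereditary.mul_idem_mem_aboveIdeal {i : V} {z : A} (hz : z ∈ offIdeal K e i) :
    z * e i ∈ aboveIdeal K e i := by
  have : offIdeal K e i ≤ (aboveIdeal K e i).comap (LinearMap.mulRight K (e i)) := by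
    refine offIdeal_le fun l a b hl => ?_
    have := mul_mul_mem_aboveIdeal (hA.idem_mul_mem_aboveIdeal he hl b) a 1
    simpa [mul_assoc] using this
  exact this hz

/-- The witness is a lift `w` of the generator of the factor `Δ(j)` in a filtration of `P(k)`. It
avoids the trace of the idempotents `e l`, `l ≰ j`, at its own step, and `IsStdStep.mem_offTrace`
carries this up to the whole of `P(k)`. -/
theorem IsOneQuasiHereditary.exists_idem_mul_notMem {j k : V} (hkj : k ≤ j) :
    ∃ a, e j * a * e k ∉ offIdeal K e j := by
  obtain ⟨F, hF⟩ := hA.proj_mult j k hkj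
  obtain ⟨s, hs, -⟩ := F.exists_unique_label hF
  obtain ⟨w, hw⟩ := F.exists_isStdStep he s
  rw [hs] at hw
  have key : ∀ t, s.succ ≤ t → w ∈ F.sub t ∧ w ∉ offTrace e j (F.sub t) := by
    intro t
    induction t using Fin.induction with
    | zero => exact fun h => absurd (lt_of_lt_of_le s.succ_pos h) (lt_irrefl _)
    | succ t ih =>
      intro h
      rcases h.eq_or_lt with heq | hlt
      · rw [← heq]
        refine ⟨hw.mem, fun hmem => ?_⟩
        -- The idempotents `e l` with `l ≰ j` annihilate `Δ(j)`, so the trace of the step lies in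
        -- the previous submodule.
        have h1 : w ∈ F.sub s.castSucc :=
          offTrace_le (fun l hl m hm => hw.idem_smul_mem hl hm) hmem
        have h2 := (hw.smul_mem_iff 1).1 (by rwa [one_smul])
        rw [one_mul] at h2
        exact hA.idem_notMem he j h2
      · obtain ⟨h1, h2⟩ := ih (Fin.le_castSucc_iff.2 hlt)
        obtain ⟨v, hv⟩ := F.exists_isStdStep he t
        exact ⟨hv.le h1, fun h3 =>
          h2 (hv.mem_offTrace he (fun i z hz => hA.mul_idem_mem_aboveIdeal he hz) h1 h3)⟩
  obtain ⟨-, h1⟩ := key (Fin.last _) (Fin.le_last _)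
  rw [F.sub_last] at h1
  refine ⟨w, fun h2 => h1 ?_⟩
  have h3 : e j * w * e k = (w : A) := by
    rw [mul_assoc, coe_mul_idem he]
    exact congrArg Subtype.val hw.idem_smul
  rw [h3] at h2
  have h4 : offIdeal K e j ≤
      ((offTrace e j (⊤ : Submodule A (projMod e k))).restrictScalars K).comap
      ((LinearMap.toSpanSingleton A _ (projGen e k)).restrictScalars K) := by
    refine offIdeal_le fun l a b hl => ?_
    have h5 := Submodule.smul_mem _ a (idem_smul_mem_offTrace (e := e) (j := j) hl
      (Submodule.mem_top : b • projGen e k ∈ ⊤))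
    rw [← mul_smul, ← mul_smul] at h5
    exact h5
  have h6 : (w : A) • projGen e k ∈ offTrace e j ⊤ := h4 h2
  rwa [coe_smul_projGen he] at h6

/-- `e t` annihilates every standard module except `Δ(t)`, which occurs once in `P(k)` and
contributes one dimension. -/
theorem IsOneQuasiHereditary.exists_top_mul_eq_smul {t : V} (ht : IsTop t) (k : V) :
    ∃ v, ∀ a, ∃ c : K, e t * a * e k = c • v := by
  obtain ⟨F, hF⟩ := hA.proj_mult t k (ht k)
  obtain ⟨s, hs, huniq⟩ := F.exists_unique_label hF
  obtain ⟨w, hw⟩ := F.exists_isStdStep he s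
  rw [hs] at hw
  have hlab : ∀ s', s' ≠ s → ¬ t ≤ F.label s' := fun s' hne h =>
    hne (huniq s' (le_antisymm (ht _) h))
  refine ⟨w, fun a => ?_⟩
  -- Three applications of `e t`: down to the step of `Δ(t)`, across it at the cost of a multiple of
  -- `w`, then down to zero.
  have h1 := F.idem_smul_mem he (l := t) s.succ (Fin.last _) (Fin.le_last _)
    (fun s' h _ => hlab s' (Fin.succ_le_castSucc_iff.1 h).ne') (a • projGen e k)
    (by rw [F.sub_last]; trivial)
  obtain ⟨c, hc⟩ := hw.exists_idem_smul_sub_mem he (hA.std_self t) (hA.idem_notMem he t) h1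
  have h2 := F.idem_smul_mem he (l := t) 0 s.castSucc (Fin.zero_le _)
    (fun s' _ h => hlab s' (Fin.succ_le_castSucc_iff.1 h).ne) _ hc
  rw [F.sub_zero, Submodule.mem_bot] at h2
  refine ⟨c, ?_⟩
  have h3 : e t * (e t * (e t * (a * e k)) - c • (w : A)) = 0 := congrArg Subtype.val h2
  have h4 : e t * (w : A) = w := congrArg Subtype.val hw.idem_smul
  rwa [mul_sub, ← mul_assoc, ← mul_assoc, ← mul_assoc, he, he, mul_smul_comm, h4,
    sub_eq_zero] at h3

end Filtrations

/-! ### Costandard modules and the dual chain -/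

section Costandard

variable {K : Type u} [Field K] {A : Type w} [Ring A] [Algebra K A] {V : Type v} {e : V → A}

instance dualRegular_finite [FiniteDimensional K A] : FiniteDimensional K (DualRegular K A) :=
  inferInstanceAs (FiniteDimensional K (Module.Dual K A))

theorem submodule_finite {M : Type x} [AddCommGroup M] [Module K M] [Module A M]
    [IsScalarTower K A M] [FiniteDimensional K M] (N : Submodule A M) :
    FiniteDimensional K N :=
  inferInstanceAs (FiniteDimensional K (N.restrictScalars K))

/-- The form `z ↦ ψ (e i z)` as an element of `I(i)`. -/
def injForm (he : ∀ i, e i * e i = e i) (i : V) (ψ : A →ₗ[K] K) : injMod K e i :=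
  ⟨ψ.comp (LinearMap.mulLeft K (e i)), fun z =>
    congrArg ψ (show e i * (e i * z) = e i * z by rw [← mul_assoc, he])⟩

variable [PartialOrder V] [FiniteDimensional K A]

/-- A submodule of `I(i)` is annihilated by all `e l`, `l ≰ i`, exactly when its forms vanish on
every `a * e l * b`: the factor `b` comes from closure under the action, and `a` from evaluation. -/
theorem mem_costdMod_iff {i : V} {φ : injMod K e i} :
    φ ∈ costdMod K e i ↔ ∀ a ∈ offIdeal K e i, DualRegular.toForm (φ : DualRegular K A) a = 0 := by
  let N₀ : Submodule A (injMod K e i) :=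
    { carrier := {φ | ∀ a ∈ offIdeal K e i, DualRegular.toForm (φ : DualRegular K A) a = 0}
      add_mem' := fun {φ χ} hφ hχ a ha => by
        change DualRegular.toForm (φ : DualRegular K A) a +
          DualRegular.toForm (χ : DualRegular K A) a = 0
        rw [hφ a ha, hχ a ha, add_zero]
      zero_mem' := fun a _ => rfl
      smul_mem' := fun b φ hφ a ha => by
        change DualRegular.toForm (φ : DualRegular K A) (a * b) = 0
        exact hφ _ (mul_mem_offIdeal_right ha b) }
  have := submodule_finite (K := K) (injMod K e i)
  have h1 : costdMod K e i ≤ N₀ := by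
    refine sSup_le fun N hN φ hφ => ?_
    have h2 : offIdeal K e i ≤ LinearMap.ker (DualRegular.toForm (φ : DualRegular K A)) := by
      refine offIdeal_le fun l a b hl => ?_
      have := submodule_finite (K := K) N
      have h3 := jhMult_eq_zero_iff.1 (hN l hl) ⟨b • φ, N.smul_mem b hφ⟩
      have h4 : e l • b • (φ : DualRegular K A) = 0 :=
        congrArg (fun χ : N => ((χ : injMod K e i) : DualRegular K A)) h3
      have h5 : DualRegular.toForm (φ : DualRegular K A) (a * e l * b) = 0 :=
        congrArg (fun χ => DualRegular.toForm χ a) h4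
      exact h5
    exact h2
  refine ⟨fun h => h1 h, fun h => ?_⟩
  have h2 : N₀ ≤ costdMod K e i := by
    refine le_sSup fun l hl => ?_
    have := submodule_finite (K := K) N₀
    rw [jhMult_eq_zero_iff]
    intro χ
    refine Subtype.ext (Subtype.ext (LinearMap.ext fun z => ?_))
    exact χ.2 _ (mul_idem_mem_offIdeal hl z)
  exact h2 h

/-- A surjection of costandard modules `∇(t) → ∇(i)`, where `t` is the largest element, is dual
to the multiplication by an element of `e t A e i`. -/
theorem exists_dual_of_surjective (he : ∀ i, e i * e i = e i) {t : V} (ht : IsTop t) {i : V}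
    (f : costdMod K e t →ₗ[A] costdMod K e i) (hf : Function.Surjective f) :
    ∃ y, e t * y = y ∧ ∀ a, y * a = 0 ↔ e i * a ∈ offIdeal K e i := by
  have hoff : offIdeal K e t = ⊥ :=
    le_bot_iff.1 (offIdeal_le fun l a b hl => absurd (ht l) hl)
  -- At the largest element `∇(t) = I(t)`, so every form `ψ` gives the element `z ↦ ψ (e t * z)`.
  let pr : (A →ₗ[K] K) → costdMod K e t := fun ψ =>
   ⟨injForm he t ψ, mem_costdMod_iff.2 fun a ha => by
    rw [hoff, Submodule.mem_bot] at ha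
    rw [ha, map_zero]⟩
  let form : ∀ {k : V}, costdMod K e k → A →ₗ[K] K := fun {k} φ =>
    DualRegular.toForm ((φ : injMod K e k) : DualRegular K A)
  have hpr : ∀ φ : costdMod K e t, pr (form φ) = φ := fun φ =>
    Subtype.ext (Subtype.ext (LinearMap.ext fun z => φ.1.2 z))
  have hform : ∀ {k : V} (φ : costdMod K e k) a, form φ (e k * a) = form φ a := fun φ a => φ.1.2 a
  -- Evaluating `f` at `e i` is a functional on the dual of `A`, so by finite dimension it is
  -- evaluation at some `y`; `A`-linearity then determines all of `f`.
  let Φ : Module.Dual K (Module.Dual K A) :=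
    { toFun := fun ψ => form (f (pr ψ)) (e i)
      map_add' := fun ψ χ => by
        have h1 : pr (ψ + χ) = pr ψ + pr χ := rfl
        rw [h1, map_add]
        rfl
      map_smul' := fun c ψ => by
        have h1 : pr (c • ψ) = c • pr ψ := rfl
        rw [h1, show f (c • pr ψ) = c • f (pr ψ) from (f.restrictScalars K).map_smul c _]
        rfl }
  obtain ⟨y, hy⟩ := (Module.evalEquiv K A).surjective Φ
  have hΦ : ∀ ψ, form (f (pr ψ)) (e i) = ψ y := fun ψ => by
    have := congrArg (fun F => F ψ) hy
    exact this.symm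
  have key : ∀ ψ a, form (f (pr ψ)) a = ψ (e t * y * a) := fun ψ a => by
    rw [← hform]
    change form (a • f (pr ψ)) (e i) = _
    rw [← map_smul, ← hpr (a • pr ψ), hΦ]
    change ψ (e t * (y * a)) = _
    rw [mul_assoc]
  refine ⟨e t * y, by rw [← mul_assoc, he], fun a => ⟨fun h => ?_, fun h => ?_⟩⟩
  · by_contra hn
    -- A form separating `e i * a` from `offIdeal` defines an element of `∇(i)`; lifting it along
    -- the surjection `f` contradicts `y * a = 0`.
    obtain ⟨ψ, hψ, hψ'⟩ := Submodule.exists_le_ker_of_notMem hn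
    let χ : costdMod K e i := ⟨injForm he i ψ, mem_costdMod_iff.2 fun b hb =>
      hψ' (mul_mem_offIdeal_left hb (e i))⟩
    obtain ⟨φ, hφ⟩ := hf χ
    have h1 := key (form φ) a
    rw [hpr, hφ, h, map_zero] at h1
    exact hψ h1
  · rw [← Module.forall_dual_apply_eq_zero_iff K]
    intro ψ
    rw [← key, ← hform]
    exact mem_costdMod_iff.1 (f (pr ψ)).2 _ h

open MulOpposite in
theorem IsOneQuasiHereditary.exists_isStdChain_op [Fintype V] (he : ∀ i, e i * e i = e i)
    (hA : IsOneQuasiHereditary K e) : ∃ y, IsStdChain K (fun k => op (e k)) y := by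
  obtain ⟨t, ht⟩ := hA.exists_greatest
  choose f hf using hA.costd_onto t ht
  choose y hty hy using fun i => exists_dual_of_surjective he ht (f i) (hf i)
  have hidem : ∀ i, y i * e i = y i := fun i => by
    have := (hy i (1 - e i)).2 (by rw [mul_sub, mul_one, he, sub_self]; exact Submodule.zero_mem _)
    rw [mul_sub, mul_one, sub_eq_zero] at this
    exact this.symm
  have hne : ∀ i, y i ≠ 0 := fun i h => by
    have := (hy i 1).1 (by rw [h, zero_mul])
    rw [mul_one] at this
    exact hA.idem_notMem he i this
  -- Both sides lie in `e t A e k`, which is at most a line, and `y k` is nonzero.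
  have hrank : ∀ i k a, ∃ c : K, y i * a * e k = c • y k := fun i k a => by
    obtain ⟨v, hv⟩ := hA.exists_top_mul_eq_smul he ht k
    obtain ⟨c, hc⟩ := hv (y i * a)
    obtain ⟨d, hd⟩ := hv (y k)
    rw [← mul_assoc, hty] at hc
    rw [hty, hidem] at hd
    have hd0 : d ≠ 0 := by
      rintro rfl
      exact hne k (by rw [hd, zero_smul])
    exact ⟨c * d⁻¹, by rw [hc, hd, smul_smul, mul_assoc, inv_mul_cancel₀ hd0, mul_one]⟩
  refine ⟨fun i => op (y i), fun i => ?_, fun i h => hne i (op_injective h), fun i k a => ?_,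
    fun i a => ?_, fun i k hki => ?_⟩
  · rw [← op_mul, hidem]
  · obtain ⟨c, hc⟩ := hrank i k a.unop
    refine ⟨c, unop_injective ?_⟩
    simpa [mul_assoc] using hc
  · rw [opSubmodule_offIdeal]
    have := hy i a.unop
    rw [← op_mem_opSubmodule, ← op_eq_zero_iff] at this
    simpa using this
  · obtain ⟨a, ha⟩ := hA.exists_idem_mul_notMem he hki
    obtain ⟨c, hc⟩ := hrank i k a
    have hc0 : c ≠ 0 := by
      rintro rfl
      rw [zero_smul, mul_assoc, hy, ← mul_assoc] at hc
      exact ha hc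
    refine ⟨op (c⁻¹ • a), unop_injective ?_⟩
    have : y i * (c⁻¹ • a) * e k = y k := by
      rw [mul_smul_comm, smul_mul_assoc, hc, smul_smul, inv_mul_cancel₀ hc0, one_smul]
    simpa [mul_assoc] using this

end Costandard

/-! ### Arrows modulo the square of the radical -/

section PathAlgebraLemmas

namespace QPath

variable {V : Type v} [Quiver.{w} V]

/-- An arrow as a path. -/
def ofHom {i j : V} (α : i ⟶ j) : QPath V := ⟨i, j, α.toPath⟩

theorem length_ofHom {i j : V} (α : i ⟶ j) : (ofHom α).length = 1 := rfl

theorem ofHom_injective {i j : V} : Function.Injective (ofHom : (i ⟶ j) → QPath V) := by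
  intro α β h
  simpa [ofHom, Quiver.Hom.toPath] using h

theorem finite_setOf_length_lt [Finite V] [∀ i j : V, Finite (i ⟶ j)] (m : ℕ) :
    {p : QPath V | p.length < m}.Finite := by
  induction m with
  | zero => simp
  | succ m ih =>
    refine ((Set.finite_range (triv (V := V))).union (ih.biUnion fun p _ =>
      Set.finite_iUnion fun c => Set.finite_range fun f : p.2.1 ⟶ c =>
        (⟨p.1, c, p.2.2.cons f⟩ : QPath V))).subset ?_
    rintro ⟨a, b, p⟩ hp
    cases p with
    | nil => exact Or.inl ⟨a, rfl⟩
    | @cons c _ p f =>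
      refine Or.inr (Set.mem_biUnion (x := ⟨a, c, p⟩) ?_ (Set.mem_iUnion.2 ⟨b, f, rfl⟩))
      simpa [length] using hp

theorem length_of_mul? {q p r : QPath V} (h : mul? q p = some r) :
    r.length = q.length + p.length := by
  obtain ⟨a, b, p⟩ := p
  obtain ⟨b', c, q⟩ := q
  by_cases hb : b' = b
  · subst hb
    rw [mul?_pos, Option.some.injEq] at h
    subst h
    simp [length, add_comm]
  · rw [mul?_neg _ _ hb] at h
    cases h

end QPath

namespace PathAlgebra

variable {K : Type u} {V : Type v} [Field K] [Quiver.{w} V]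

theorem ofPath_mem_arrowPow {m : ℕ} {p : QPath V} (h : m ≤ p.length) :
    ofPath K p ∈ arrowPow K V m :=
  Submodule.subset_span ⟨p, h, rfl⟩

theorem arrowPow_le {m : ℕ} {N : Submodule K (PathAlgebra K V)}
    (h : ∀ p : QPath V, m ≤ p.length → ofPath K p ∈ N) : arrowPow K V m ≤ N := by
  refine Submodule.span_le.2 ?_
  rintro z ⟨p, hp, rfl⟩
  exact h p hp

theorem arrowPow_anti {m n : ℕ} (h : m ≤ n) : arrowPow K V n ≤ arrowPow K V m :=
  arrowPow_le fun _ hp => ofPath_mem_arrowPow (h.trans hp)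

theorem mem_arrowPow_zero (x : PathAlgebra K V) : x ∈ arrowPow K V 0 := by
  have h : ⊤ ≤ arrowPow K V 0 := by
    rw [← (basis K (V := V)).span_eq, Submodule.span_le]
    rintro _ ⟨p, rfl⟩
    exact ofPath_mem_arrowPow (Nat.zero_le _)
  exact h trivial

open Classical in
theorem coord_ofPath (p q : QPath V) :
    (basis K).coord p (ofPath K q) = if q = p then 1 else 0 := by
  rw [← basis_apply, Module.Basis.coord_apply, Module.Basis.repr_self, Finsupp.single_apply]

theorem coord_eq_zero_of_mem_arrowPow {m : ℕ} {x : PathAlgebra K V} (hx : x ∈ arrowPow K V m)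
    {p : QPath V} (hp : p.length < m) : (basis K).coord p x = 0 := by
  have : arrowPow K V m ≤ LinearMap.ker ((basis K).coord p) := by
    refine arrowPow_le fun q hq => ?_
    rw [LinearMap.mem_ker, coord_ofPath, if_neg]
    rintro rfl
    exact absurd hq hp.not_ge
  exact this hx

theorem ofPath_mul_mem_arrowPow {m n : ℕ} {q p : QPath V} (hq : m ≤ q.length) (hp : n ≤ p.length) :
    ofPath K q * ofPath K p ∈ arrowPow K V (m + n) := by
  rw [ofPath_mul]
  cases h : QPath.mul? q p with
  | none => exact Submodule.zero_mem _
  | some r =>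
    refine ofPath_mem_arrowPow ?_
    rw [QPath.length_of_mul? h]
    omega

theorem ofPath_cons {a b c : V} (p : Quiver.Path a b) (f : b ⟶ c) :
    ofPath K ⟨a, c, p.cons f⟩ = ofPath K (QPath.ofHom f) * ofPath K ⟨a, b, p⟩ := by
  rw [ofPath_mul, QPath.ofHom, QPath.mul?_pos]
  rfl

variable [Fintype V]

theorem mul_mem_arrowPow {m n : ℕ} {x y : PathAlgebra K V} (hx : x ∈ arrowPow K V m)
    (hy : y ∈ arrowPow K V n) : x * y ∈ arrowPow K V (m + n) := by
  have h1 : ∀ q : QPath V, m ≤ q.length →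
      arrowPow K V n ≤ (arrowPow K V (m + n)).comap (LinearMap.mulLeft K (ofPath K q)) :=
    fun q hq => arrowPow_le fun p hp => ofPath_mul_mem_arrowPow hq hp
  have h2 : arrowPow K V m ≤ (arrowPow K V (m + n)).comap (LinearMap.mulRight K y) :=
    arrowPow_le fun q hq => h1 q hq hy
  exact h2 hx

theorem idem_mul_idem [DecidableEq V] (i j : V) :
    idem K i * idem K j = if i = j then idem K i else 0 := by
  have := idem_mul_ofPath K i (QPath.triv j)
  change idem K i * idem K j = if i = j then idem K j else 0 at this
  rw [this]
  split_ifs with h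
  · rw [h]
  · rfl

open Classical in
theorem idem_mul_ofPath_mul_idem (i j : V) (p : QPath V) :
    idem K j * ofPath K p * idem K i = if j = p.2.1 ∧ p.1 = i then ofPath K p else 0 := by
  rw [idem_mul_ofPath]
  by_cases h : j = p.2.1
  · simp [h, ofPath_mul_idem]
  · simp [h]

variable {A : Type x} [Ring A] [Algebra K A]

/-- The image of the `m`-th power of the arrow ideal in a quotient of the path algebra. -/
noncomputable def imagePow (f : PathAlgebra K V →ₐ[K] A) (m : ℕ) : Submodule K A :=
  (arrowPow K V m).map f.toLinearMap

/-- The image of the trivial path at `i` in a quotient of the path algebra. -/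
noncomputable def imageIdem (f : PathAlgebra K V →ₐ[K] A) (i : V) : A :=
  f (idem K i)

/-- A presentation of an algebra as the quotient of a path algebra by an admissible ideal. -/
structure IsAdmissiblePresentation (f : PathAlgebra K V →ₐ[K] A) : Prop where
  surjective : Function.Surjective f
  ker_le : ∀ x, f x = 0 → x ∈ arrowPow K V 2
  le_ker : ∃ m, ∀ x ∈ arrowPow K V m, f x = 0

variable {f : PathAlgebra K V →ₐ[K] A}

theorem map_mem_imagePow {m : ℕ} {x : PathAlgebra K V} (hx : x ∈ arrowPow K V m) :
    f x ∈ imagePow f m :=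
  ⟨x, hx, rfl⟩

theorem mem_arrowPow_of_map_mem {m : ℕ} (hf : ∀ y, f y = 0 → y ∈ arrowPow K V m)
    {x : PathAlgebra K V}
    (hx : f x ∈ imagePow f m) : x ∈ arrowPow K V m := by
  obtain ⟨y, hy, hyx⟩ := hx
  have h1 : f (x - y) = 0 := by rw [map_sub, ← hyx]; exact sub_self _
  simpa using Submodule.add_mem _ (hf _ h1) hy

theorem imagePow_le {m : ℕ} {N : Submodule K A}
    (h : ∀ p : QPath V, m ≤ p.length → f (ofPath K p) ∈ N) :
    imagePow f m ≤ N :=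
  Submodule.map_le_iff_le_comap.2 (arrowPow_le h)

theorem imagePow_anti {m n : ℕ} (h : m ≤ n) : imagePow f n ≤ imagePow f m :=
  imagePow_le fun _ hp => map_mem_imagePow (ofPath_mem_arrowPow (h.trans hp))

theorem mem_imagePow_zero (hf : Function.Surjective f) (a : A) : a ∈ imagePow f 0 := by
  obtain ⟨x, rfl⟩ := hf a
  exact map_mem_imagePow (mem_arrowPow_zero x)

theorem mul_mem_imagePow {m n : ℕ} {a b : A} (ha : a ∈ imagePow f m)
    (hb : b ∈ imagePow f n) : a * b ∈ imagePow f (m + n) := by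
  obtain ⟨x, hx, rfl⟩ := ha
  obtain ⟨y, hy, rfl⟩ := hb
  exact ⟨x * y, mul_mem_arrowPow hx hy, map_mul f x y⟩

theorem imageIdem_mul_self (i : V) : imageIdem f i * imageIdem f i = imageIdem f i := by
  classical
  rw [imageIdem, ← map_mul, idem_mul_idem, if_pos rfl]

theorem imageIdem_mul_of_ne {i j : V} (hij : i ≠ j) : imageIdem f i * imageIdem f j = 0 := by
  classical
  rw [imageIdem, imageIdem, ← map_mul, idem_mul_idem, if_neg hij, map_zero]

theorem sum_imageIdem : ∑ i, imageIdem f i = 1 := by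
  simp only [imageIdem]
  rw [← map_sum, ← one_def, map_one]

theorem mul_mem_imagePow_left (hf : Function.Surjective f) {m : ℕ} (a : A) {b : A}
    (hb : b ∈ imagePow f m) : a * b ∈ imagePow f m := by
  have := mul_mem_imagePow (mem_imagePow_zero hf a) hb
  rwa [zero_add] at this

theorem mul_mem_imagePow_right (hf : Function.Surjective f) {m : ℕ} (a : A) {b : A}
    (hb : b ∈ imagePow f m) : b * a ∈ imagePow f m := by
  have := mul_mem_imagePow hb (mem_imagePow_zero hf a)
  rwa [add_zero] at this

/-- To bound `e j (Rᵐ / I) e i` it suffices to consider the paths from `i` to `j`. -/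
theorem idem_mul_mul_idem_mem {m : ℕ} {i j : V} {N : Submodule K A}
    (h : ∀ p : Quiver.Path i j, m ≤ p.length → f (ofPath K ⟨i, j, p⟩) ∈ N)
    {a : A} (ha : a ∈ imagePow f m) : imageIdem f j * a * imageIdem f i ∈ N := by
  have : imagePow f m ≤ N.comap ((LinearMap.mulRight K (imageIdem f i)).comp
      (LinearMap.mulLeft K (imageIdem f j))) := by
    refine imagePow_le fun p hp => ?_
    change f (idem K j) * f (ofPath K p) * f (idem K i) ∈ N
    rw [← map_mul, ← map_mul, idem_mul_ofPath_mul_idem]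
    split_ifs with hij
    · obtain ⟨a, b, p⟩ := p
      obtain ⟨rfl, rfl⟩ := hij
      exact h p hp
    · rw [map_zero]
      exact N.zero_mem
  exact this ha

theorem idem_mul_mul_idem_mem_of_ne (hf : Function.Surjective f) {i j : V} (hij : i ≠ j) (a : A) :
    imageIdem f i * a * imageIdem f j ∈ imagePow f 1 := by
  refine idem_mul_mul_idem_mem (fun p _ => map_mem_imagePow (ofPath_mem_arrowPow ?_))
    (mem_imagePow_zero hf a)
  cases p with
  | nil => exact absurd rfl hij
  | cons p α => exact Nat.succ_le_succ (Nat.zero_le _)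

/-- The kernel lies in the arrow ideal, so membership lifts to the path algebra, where the
coefficient of the trivial path is `1`. -/
theorem imageIdem_notMem (hf : IsAdmissiblePresentation f) (i : V) :
    imageIdem f i ∉ imagePow f 1 := by
  intro h
  have h1 := coord_eq_zero_of_mem_arrowPow
    (mem_arrowPow_of_map_mem (fun y hy => arrowPow_anti one_le_two (hf.ker_le y hy)) h)
    (p := QPath.triv i) Nat.zero_lt_one
  rw [idem, coord_ofPath, if_pos rfl] at h1
  exact one_ne_zero h1

theorem imagePow_two_le {N : Submodule K A}
    (hN : ∀ a ∈ imagePow f 1, ∀ b ∈ imagePow f 1, a * b ∈ N) : imagePow f 2 ≤ N := by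
  refine imagePow_le fun p hp => ?_
  obtain ⟨a, b, p⟩ := p
  cases p with
  | nil => exact absurd hp (by simp [QPath.length])
  | cons p α =>
    rw [ofPath_cons, map_mul]
    exact hN _ (map_mem_imagePow (ofPath_mem_arrowPow le_rfl)) _
      (map_mem_imagePow (ofPath_mem_arrowPow (Nat.le_of_succ_le_succ hp)))

theorem isRadicalPair (hf : IsAdmissiblePresentation f) :
    IsRadicalPair (imageIdem f) (imagePow f 1) (imagePow f 2) where
  idem := imageIdem_mul_self
  orth _ _ := imageIdem_mul_of_ne
  complete := sum_imageIdem
  mul_left_mem a _ := mul_mem_imagePow_left hf.surjective a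
  mul_right_mem a _ := mul_mem_imagePow_right hf.surjective a
  offdiag_mem _ _ a hij := idem_mul_mul_idem_mem_of_ne hf.surjective hij a
  idem_notMem := imageIdem_notMem hf
  sq_le := imagePow_anti one_le_two
  mul_mem_sq _ ha _ hb := mul_mem_imagePow (m := 1) (n := 1) ha hb
  sq_le_of _ := imagePow_two_le

theorem finiteDimensional_quotient [∀ i j : V, Finite (i ⟶ j)] (hf : IsAdmissiblePresentation f) :
    FiniteDimensional K A := by
  obtain ⟨m, hm⟩ := hf.le_ker
  let s : Set A :=
    (fun p => f (ofPath K p)) '' {p : QPath V | p.length < m}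
  have hs : s.Finite := (QPath.finite_setOf_length_lt m).image _
  refine ⟨⟨hs.toFinset, eq_top_iff.2 fun a _ => ?_⟩⟩
  rw [hs.coe_toFinset]
  refine imagePow_le (m := 0) (fun p _ => ?_) (mem_imagePow_zero hf.surjective a)
  by_cases hp : p.length < m
  · exact Submodule.subset_span ⟨p, hp, rfl⟩
  · rw [hm _ (ofPath_mem_arrowPow (not_lt.1 hp))]
    exact Submodule.zero_mem _

theorem idem_mul_ofHom_mul_idem {i j : V} (α : i ⟶ j) :
    imageIdem f j * f (ofPath K (QPath.ofHom α)) * imageIdem f i =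
      f (ofPath K (QPath.ofHom α)) := by
  rw [imageIdem, imageIdem, ← map_mul, ← map_mul, idem_mul_ofPath_mul_idem, if_pos ⟨rfl, rfl⟩]

/-- The classes of the arrows `i → j` are linearly independent modulo the square of the radical. -/
theorem eq_zero_of_smul_ofHom_add_mem (hf : IsAdmissiblePresentation f) {i j : V} {α β : i ⟶ j}
    (hαβ : α ≠ β) {c d : K} (h : c • f (ofPath K (QPath.ofHom α)) +
      d • f (ofPath K (QPath.ofHom β)) ∈ imagePow f 2) : c = 0 := by
  have h1 : f (c • ofPath K (QPath.ofHom α) + d • ofPath K (QPath.ofHom β)) ∈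
      imagePow f 2 := by
    rwa [map_add, map_smul, map_smul]
  have h2 := coord_eq_zero_of_mem_arrowPow (mem_arrowPow_of_map_mem hf.ker_le h1)
    (p := QPath.ofHom α) Nat.one_lt_two
  rw [map_add, map_smul, map_smul, coord_ofPath, coord_ofPath, if_pos rfl,
    if_neg fun h => hαβ (QPath.ofHom_injective h).symm] at h2
  simpa using h2

theorem ofHom_notMem (hf : IsAdmissiblePresentation f) {i j : V} (α : i ⟶ j) :
    f (ofPath K (QPath.ofHom α)) ∉ imagePow f 2 := by
  intro h
  have h2 := coord_eq_zero_of_mem_arrowPow (mem_arrowPow_of_map_mem hf.ker_le h)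
    (p := QPath.ofHom α) Nat.one_lt_two
  rw [coord_ofPath, if_pos rfl] at h2
  exact one_ne_zero h2

/-- Without arrows `i → j`, a path from `i` to `j` of positive length has length at least two. -/
theorem idem_mul_mem_of_isEmpty {i j : V} [IsEmpty (i ⟶ j)] {a : A}
    (ha : a ∈ imagePow f 1) : imageIdem f j * a * imageIdem f i ∈ imagePow f 2 := by
  refine idem_mul_mul_idem_mem (fun p hp => map_mem_imagePow (ofPath_mem_arrowPow ?_)) ha
  match p, hp with
  | .cons .nil α, _ => exact isEmptyElim α
  | .cons (.cons p _) _, _ => exact Nat.succ_le_succ (Nat.succ_le_succ (Nat.zero_le _))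

/-- The hypotheses say that `e j A e i` is a line modulo the radical square. Independence of the
arrow classes allows at most one arrow, and `u` forces at least one. -/
theorem card_hom_eq_one (hf : IsAdmissiblePresentation f) {i j : V} (hij : i ≠ j)
    {u : A} (hu : imageIdem f j * u * imageIdem f i ∉ imagePow f 2)
    (h : ∀ a, ∃ c : K, imageIdem f j * a * imageIdem f i - c • (imageIdem f j * u * imageIdem f i) ∈
      (imagePow f 2 : Submodule K _)) : Nat.card (i ⟶ j) = 1 := by
  have hR := isRadicalPair hf
  rw [Nat.card_eq_one_iff_unique]
  constructor
  · refine ⟨fun α β => ?_⟩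
    by_contra hne
    obtain ⟨c, hc⟩ := h (f (ofPath K (QPath.ofHom α)))
    obtain ⟨d, hd⟩ := h (f (ofPath K (QPath.ofHom β)))
    rw [idem_mul_ofHom_mul_idem] at hc hd
    -- `d α - c β` lies in the radical square, so `d = 0`, which puts `β` itself there.
    have h1 := Submodule.sub_mem _ (Submodule.smul_mem _ d hc) (Submodule.smul_mem _ c hd)
    rw [smul_sub, smul_sub, smul_smul, smul_smul, mul_comm d c, sub_sub_sub_cancel_right,
      sub_eq_add_neg, ← neg_smul] at h1
    rw [eq_zero_of_smul_ofHom_add_mem hf hne h1, zero_smul, sub_zero] at hd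
    exact ofHom_notMem hf β hd
  · by_contra hne
    rw [not_nonempty_iff] at hne
    have h1 := idem_mul_mem_of_isEmpty (f := f) (i := i) (j := j) (hR.offdiag_mem j i u hij.symm)
    rw [← mul_assoc, ← mul_assoc, hR.idem, mul_assoc _ (imageIdem f i), hR.idem] at h1
    exact hu h1

variable [PartialOrder V] [∀ i j : V, Finite (i ⟶ j)]

theorem card_hom_eq_one_of_neighbours (hf : IsAdmissiblePresentation f)
    (hA : IsOneQuasiHereditary K (imageIdem f)) {i j : V} (hij : i ⋖ j ∨ j ⋖ i) :
    Nat.card (i ⟶ j) = 1 := by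
  have := finiteDimensional_quotient hf
  have hR := isRadicalPair hf
  obtain ⟨x, hx⟩ := hA.exists_isStdChain hR.idem
  obtain ⟨y, hy⟩ := hA.exists_isStdChain_op hR.idem
  obtain ⟨u, hu, hu'⟩ := hR.exists_irreducible_of_neighbours hx hy hij
  exact card_hom_eq_one hf (hij.elim (fun h => h.ne) (fun h => h.ne')) hu hu'

theorem neighbours_of_hom (hf : IsAdmissiblePresentation f)
    (hA : IsOneQuasiHereditary K (imageIdem f)) {i j : V} (α : i ⟶ j) :
    i ⋖ j ∨ j ⋖ i := by
  have := finiteDimensional_quotient hf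
  have hR := isRadicalPair hf
  obtain ⟨x, hx⟩ := hA.exists_isStdChain hR.idem
  obtain ⟨y, hy⟩ := hA.exists_isStdChain_op hR.idem
  by_contra hn
  have h1 := hR.mem_sq_of_not_neighbours hx hy
    (fun i l a hl => hA.idem_mul_mem_aboveIdeal hR.idem hl a) hn
    (map_mem_imagePow (f := f) (ofPath_mem_arrowPow (QPath.length_ofHom α).ge))
  rw [idem_mul_ofHom_mul_idem] at h1
  exact ofHom_notMem hf α h1

end PathAlgebra

end PathAlgebraLemmas

/-! ### Coefficient forms, radicals of projectives and simple modules -/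

section Simples

namespace QPath

variable {V : Type v} [Quiver.{w} V]

theorem length_triv_lt (i : V) : (triv i).length < 2 := Nat.zero_lt_two

theorem length_ofHom_lt {i j : V} (α : i ⟶ j) : (ofHom α).length < 2 := Nat.one_lt_two

end QPath

namespace PathAlgebra

variable {K : Type u} {V : Type v} [Field K] [Quiver.{w} V] [Fintype V]
  {A : Type x} [Ring A] [Algebra K A] {f : PathAlgebra K V →ₐ[K] A}

/-- An arrow ending at `j` factors only as `e j * α` or `α * e k`, and the second is excluded
because `y` has no trivial paths. This identity makes the coefficient of `α` a homomorphism `rad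
P(k) → S(j)`. -/
theorem coord_mul_of_mem (j : V) {k : V} (α : k ⟶ j) (x : PathAlgebra K V) {y : PathAlgebra K V}
    (hy : y ∈ arrowPow K V 1) :
    (basis K).coord (QPath.ofHom α) (x * y) =
      (basis K).coord (QPath.triv j) x * (basis K).coord (QPath.ofHom α) y := by
  classical
  have key : ∀ p : QPath V, arrowPow K V 1 ≤ LinearMap.ker
      ((((basis K).coord (QPath.ofHom α)).comp (LinearMap.mulLeft K (ofPath K p))) -
        (basis K).coord (QPath.triv j) (ofPath K p) • (basis K).coord (QPath.ofHom α)) := by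
    intro p
    refine arrowPow_le fun q hq => ?_
    change (basis K).coord (QPath.ofHom α) (ofPath K p * ofPath K q) -
      (basis K).coord (QPath.triv j) (ofPath K p) * (basis K).coord (QPath.ofHom α) (ofPath K q) = 0
    obtain ⟨a, b, p⟩ := p
    cases p with
    | nil =>
      change (basis K).coord (QPath.ofHom α) (idem K a * ofPath K q) -
        (basis K).coord (QPath.triv j) (ofPath K (QPath.triv a)) *
          (basis K).coord (QPath.ofHom α) (ofPath K q) = 0
      rw [idem_mul_ofPath, coord_ofPath, coord_ofPath]
      by_cases haj : a = j
      · subst haj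
        rw [if_pos rfl, one_mul]
        split_ifs with h1 h2 h2
        · rw [h2, coord_ofPath, if_pos rfl, sub_self]
        · rw [coord_ofPath, if_neg h2, sub_self]
        · rw [h2] at h1
          exact absurd rfl h1
        · rw [map_zero, sub_self]
      · rw [if_neg (fun h => haj (congrArg Sigma.fst h)), zero_mul, sub_zero]
        split_ifs with h1
        · rw [coord_ofPath, if_neg]
          rintro rfl
          exact haj h1
        · rw [map_zero]
    | cons p β =>
      have h1 : 1 ≤ QPath.length (⟨a, b, p.cons β⟩ : QPath V) := Nat.succ_le_succ (Nat.zero_le _)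
      rw [coord_eq_zero_of_mem_arrowPow (ofPath_mul_mem_arrowPow h1 hq)
          (p := QPath.ofHom α) Nat.one_lt_two,
        coord_eq_zero_of_mem_arrowPow (ofPath_mem_arrowPow h1) (p := QPath.triv j) Nat.zero_lt_one,
        zero_mul, sub_zero]
  have key2 : arrowPow K V 0 ≤ LinearMap.ker
      ((((basis K).coord (QPath.ofHom α)).comp (LinearMap.mulRight K y)) -
        (basis K).coord (QPath.ofHom α) y • (basis K).coord (QPath.triv j)) := by
    refine arrowPow_le fun p _ => ?_
    have := key p hy
    rw [LinearMap.mem_ker, LinearMap.sub_apply, sub_eq_zero] at this ⊢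
    exact this.trans (mul_comm _ _)
  have := key2 (mem_arrowPow_zero x)
  rw [LinearMap.mem_ker, LinearMap.sub_apply, sub_eq_zero] at this
  exact this.trans (mul_comm _ _)

theorem mul_idem_sub_mem (j : V) (x : PathAlgebra K V) :
    x * idem K j - (basis K).coord (QPath.triv j) x • idem K j ∈ arrowPow K V 1 := by
  classical
  have key : arrowPow K V 0 ≤ (arrowPow K V 1).comap (LinearMap.mulRight K (idem K j) -
      ((basis K).coord (QPath.triv j)).smulRight (idem K j)) := by
    refine arrowPow_le fun p _ => ?_
    change ofPath K p * idem K j -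
      (basis K).coord (QPath.triv j) (ofPath K p) • idem K j ∈ arrowPow K V 1
    obtain ⟨a, b, p⟩ := p
    cases p with
    | nil =>
      change idem K a * idem K j -
        (basis K).coord (QPath.triv j) (ofPath K (QPath.triv a)) • idem K j ∈ arrowPow K V 1
      rw [idem_mul_idem, coord_ofPath]
      by_cases haj : a = j
      · subst haj
        rw [if_pos rfl, if_pos rfl, one_smul, sub_self]
        exact Submodule.zero_mem _
      · rw [if_neg haj, if_neg (fun h => haj (congrArg Sigma.fst h)), zero_smul, sub_self]
        exact Submodule.zero_mem _
    | cons p β =>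
      have h1 : 1 ≤ QPath.length (⟨a, b, p.cons β⟩ : QPath V) := Nat.succ_le_succ (Nat.zero_le _)
      rw [coord_eq_zero_of_mem_arrowPow (ofPath_mem_arrowPow h1) (p := QPath.triv j)
        Nat.zero_lt_one, zero_smul, sub_zero]
      exact ofPath_mul_mem_arrowPow (n := 0) h1 (Nat.zero_le _)
  exact key (mem_arrowPow_zero x)

namespace IsAdmissiblePresentation

variable (hf : IsAdmissiblePresentation f)
include hf

/-- The kernel of `f` involves only paths of length at least two, so coefficients of shorter paths
descend to `A`. -/
theorem exists_imageCoord (p : QPath V) (hp : p.length < 2) :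
    ∃ φ : A →ₗ[K] K, ∀ x, φ (f x) = (basis K).coord p x := by
  have hker : LinearMap.ker f.toLinearMap ≤ LinearMap.ker ((basis K).coord p) := fun x hx =>
    coord_eq_zero_of_mem_arrowPow (hf.ker_le x hx) hp
  let g := f.toLinearMap.quotKerEquivOfSurjective hf.surjective
  refine ⟨((LinearMap.ker f.toLinearMap).liftQ _ hker).comp g.symm.toLinearMap, fun x => ?_⟩
  have h1 : g.symm (f x) = (LinearMap.ker f.toLinearMap).mkQ x := by
    rw [LinearEquiv.symm_apply_eq]
    rfl
  rw [LinearMap.comp_apply, LinearEquiv.coe_coe, h1]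
  rfl

/-- The coefficient of a path of length at most one, as a linear form on the quotient. -/
noncomputable def imageCoord (p : QPath V) (hp : p.length < 2) : A →ₗ[K] K :=
  (hf.exists_imageCoord p hp).choose

theorem imageCoord_apply (p : QPath V) (hp : p.length < 2) (x : PathAlgebra K V) :
    hf.imageCoord p hp (f x) = (basis K).coord p x :=
  (hf.exists_imageCoord p hp).choose_spec x

/-- The coefficient of the trivial path at `j`. -/
noncomputable def vertexForm (j : V) : A →ₗ[K] K :=
  hf.imageCoord (QPath.triv j) (QPath.length_triv_lt j)

/-- The coefficient of an arrow. -/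
noncomputable def arrowForm {i j : V} (α : i ⟶ j) : A →ₗ[K] K :=
  hf.imageCoord (QPath.ofHom α) (QPath.length_ofHom_lt α)

theorem mul_imageIdem_sub_mem (j : V) (a : A) :
    a * imageIdem f j - hf.vertexForm j a • imageIdem f j ∈ imagePow f 1 := by
  obtain ⟨x, rfl⟩ := hf.surjective a
  rw [vertexForm, imageCoord_apply, imageIdem, ← map_mul, ← map_smul, ← map_sub]
  exact map_mem_imagePow (mul_idem_sub_mem j x)

theorem arrowForm_mul {i j : V} (α : i ⟶ j) (a : A) {b : A} (hb : b ∈ imagePow f 1) :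
    hf.arrowForm α (a * b) = hf.vertexForm j a * hf.arrowForm α b := by
  obtain ⟨x, rfl⟩ := hf.surjective a
  obtain ⟨y, hy, rfl⟩ := hb
  have h := coord_mul_of_mem j α x hy
  rw [← hf.imageCoord_apply (QPath.ofHom α) (QPath.length_ofHom_lt α),
    ← hf.imageCoord_apply (QPath.ofHom α) (QPath.length_ofHom_lt α),
    ← hf.imageCoord_apply (QPath.triv j) (QPath.length_triv_lt j), map_mul] at h
  exact h

theorem vertexForm_eq_zero (j : V) {b : A} (hb : b ∈ imagePow f 1) : hf.vertexForm j b = 0 := by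
  obtain ⟨y, hy, rfl⟩ := hb
  exact (hf.imageCoord_apply _ _ y).trans (coord_eq_zero_of_mem_arrowPow hy Nat.zero_lt_one)

theorem vertexForm_imageIdem [DecidableEq V] (j k : V) :
    hf.vertexForm j (imageIdem f k) = if k = j then 1 else 0 := by
  rw [vertexForm, imageIdem, imageCoord_apply, idem, coord_ofPath]
  by_cases h : k = j
  · rw [h, if_pos rfl, if_pos rfl]
  · rw [if_neg h, if_neg fun h' => h (congrArg Sigma.fst h')]

theorem arrowForm_ofHom [∀ i j : V, DecidableEq (i ⟶ j)] {i j : V} (α β : i ⟶ j) :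
    hf.arrowForm α (f (ofPath K (QPath.ofHom β))) = if β = α then 1 else 0 := by
  rw [arrowForm, imageCoord_apply, coord_ofPath]
  by_cases h : β = α
  · rw [h, if_pos rfl, if_pos rfl]
  · rw [if_neg h, if_neg fun h' => h (QPath.ofHom_injective h')]

theorem isNilpotent_of_mem {b : A} (hb : b ∈ imagePow f 1) : IsNilpotent b := by
  obtain ⟨m, hm⟩ := hf.le_ker
  have h : ∀ n, b ^ n ∈ imagePow f n := fun n => by
    induction n with
    | zero => exact mem_imagePow_zero hf.surjective _
    | succ n ih =>
      rw [pow_succ]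
      exact mul_mem_imagePow ih hb
  refine ⟨m, ?_⟩
  obtain ⟨x, hx, hxb⟩ := h m
  rw [← hxb]
  exact hm x hx

/-- The elements of `P(i)` in the radical form a maximal submodule, since modulo them `P(i)` is
spanned by `e i`. Conversely, they lie in every maximal submodule by nilpotency. -/
theorem mem_jacobson_iff {i : V} {z : projMod (imageIdem f) i} :
    z ∈ Module.jacobson A (projMod (imageIdem f) i) ↔ (z : A) ∈ imagePow f 1 := by
  have hR := isRadicalPair hf
  constructor
  · intro hz
    let N : Submodule A (projMod (imageIdem f) i) :=
      { carrier := {z | (z : A) ∈ imagePow f 1}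
        add_mem' := fun ha hb => (imagePow f 1).add_mem ha hb
        zero_mem' := (imagePow f 1).zero_mem
        smul_mem' := fun a z hz => hR.mul_left_mem a z hz }
    have hN : IsCoatom N := by
      constructor
      · intro h
        have h1 : projGen (imageIdem f) i ∈ N := h ▸ trivial
        exact hR.idem_notMem i h1
      · intro L hL
        obtain ⟨b, hbL, hbN⟩ := SetLike.exists_of_lt hL
        obtain ⟨c, hc⟩ : ∃ c : K, b - c • projGen (imageIdem f) i ∈ N := by
          have h1 := hf.mul_imageIdem_sub_mem i (b : A)
          rw [coe_mul_idem hR.idem] at h1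
          exact ⟨_, h1⟩
        have hc0 : c ≠ 0 := by
          rintro rfl
          rw [zero_smul, sub_zero] at hc
          exact hbN hc
        have h2 : c • projGen (imageIdem f) i ∈ L := by
          have := L.sub_mem hbL (hL.le hc)
          rwa [sub_sub_cancel] at this
        have h3 : projGen (imageIdem f) i ∈ L :=
          ((L.restrictScalars K).smul_mem_iff hc0).1 h2
        refine eq_top_iff.2 fun z _ => ?_
        obtain ⟨a, rfl⟩ := exists_smul_projGen z
        exact L.smul_mem a h3
    have h1 : Module.jacobson A (projMod (imageIdem f) i) ≤ N := sInf_le hN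
    exact h1 hz
  · intro hz
    refine Submodule.mem_sInf.2 fun N hN => ?_
    by_contra hzN
    have h1 : N ⊔ Submodule.span A {z} = ⊤ := hN.2 _ (left_lt_sup.2 fun h =>
      hzN (h (Submodule.mem_span_singleton_self z)))
    have h2 : projGen (imageIdem f) i ∈ N ⊔ Submodule.span A {z} := h1 ▸ trivial
    obtain ⟨y, hy, t, ht, hyt⟩ := Submodule.mem_sup.1 h2
    obtain ⟨a, rfl⟩ := Submodule.mem_span_singleton.1 ht
    -- From `e i = y + a z` with `y ∈ N` and `a z` nilpotent, `1 - a z` is invertible; thus `e i ∈ A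
    -- y ⊆ N`, contradicting properness.
    obtain ⟨r, hr⟩ :=
      (hf.isNilpotent_of_mem (hR.mul_left_mem a z hz)).isUnit_one_sub.exists_left_inv
    have h3 : projGen (imageIdem f) i = r • y := by
      have h4 : y = (1 - a * z) • projGen (imageIdem f) i := by
        rw [sub_smul, one_smul, mul_smul, coe_smul_projGen hR.idem, ← hyt, add_sub_cancel_right]
      rw [h4, ← mul_smul, hr, one_smul]
    refine hN.1 (eq_top_iff.2 fun z _ => ?_)
    obtain ⟨a, rfl⟩ := exists_smul_projGen z
    rw [h3]
    exact N.smul_mem _ (N.smul_mem _ hy)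

omit hf in
variable (f) in
/-- The generator of `S(j)`. -/
noncomputable def simpleGen (j : V) : simpleMod (imageIdem f) j :=
  (Module.jacobson A _).mkQ (projGen (imageIdem f) j)

/-- `A` acts on `S(j)` through the character `vertexForm j`. Scalars are written with `algebraMap`,
so that only the `A`-action is involved. -/
theorem smul_simpleGen (j : V) (a : A) :
    a • simpleGen f j = algebraMap K A (hf.vertexForm j a) • simpleGen f j := by
  rw [← sub_eq_zero, ← sub_smul, simpleGen, ← map_smul, Submodule.mkQ_apply,
    Submodule.Quotient.mk_eq_zero, hf.mem_jacobson_iff]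
  change (a - algebraMap K A (hf.vertexForm j a)) * imageIdem f j ∈ _
  rw [sub_mul, ← Algebra.smul_def]
  exact hf.mul_imageIdem_sub_mem j a

theorem exists_eq_smul_simpleGen {j : V} (s : simpleMod (imageIdem f) j) :
    ∃ c : K, s = algebraMap K A c • simpleGen f j := by
  obtain ⟨z, rfl⟩ := (Module.jacobson A _).mkQ_surjective s
  obtain ⟨a, rfl⟩ := exists_smul_projGen z
  refine ⟨hf.vertexForm j a, ?_⟩
  rw [map_smul]
  exact hf.smul_simpleGen j a

theorem algebraMap_smul_simpleGen_eq_zero_iff {j : V} {c : K} :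
    algebraMap K A c • simpleGen f j = 0 ↔ c = 0 := by
  refine ⟨fun h => ?_, fun h => by rw [h, map_zero, zero_smul]⟩
  rw [simpleGen, ← map_smul, Submodule.mkQ_apply, Submodule.Quotient.mk_eq_zero,
    hf.mem_jacobson_iff] at h
  by_contra hc
  refine (isRadicalPair hf).idem_notMem j (((imagePow f 1).smul_mem_iff hc).1 ?_)
  rw [Algebra.smul_def]
  exact h

end IsAdmissiblePresentation

end PathAlgebra

end Simples

/-! ### `Ext¹` between simples by dimension shifting -/

section ExtOne

open Abelian

/-- If `0 → X₁ → X₂ → X₃ → 0` is exact with `X₂` projective and every morphism `X₁ → Y` which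
extends to `X₂` is zero, then `Hom(X₁, Y) ≅ Ext¹(X₃, Y)`. -/
noncomputable def extOneEquivOfProjective (K : Type u) [Field K] {C : Type v} [Category.{w} C]
    [Abelian C] [Linear K C] [HasExt.{x} C] {S : ShortComplex C} (hS : S.ShortExact)
    [Projective S.X₂] (Y : C) (h : ∀ g : S.X₂ ⟶ Y, S.f ≫ g = 0) :
    (S.X₁ ⟶ Y) ≃ₗ[K] Ext S.X₃ Y 1 :=
  LinearEquiv.ofBijective
    ((Ext.precompOfLinear hS.extClass K Y (add_zero 1)).comp
      (Ext.linearEquiv₀ (R := K)).symm.toLinearMap) (by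
    constructor
    · rw [← LinearMap.ker_eq_bot, LinearMap.ker_eq_bot']
      intro g hg
      obtain ⟨x₂, hx₂⟩ := Ext.contravariant_sequence_exact₁ hS Y (Ext.mk₀ g) (add_zero 1) hg
      obtain ⟨g', rfl⟩ := Ext.homEquiv₀.symm.surjective x₂
      have h1 : Ext.mk₀ (S.f ≫ g') = Ext.mk₀ g := by
        rw [← hx₂]
        exact (Ext.mk₀_comp_mk₀ _ _).symm
      rw [h] at h1
      exact (Ext.homEquiv₀.symm.injective h1).symm
    · intro y
      obtain ⟨x₁, hx₁⟩ := Ext.contravariant_sequence_exact₃ hS Y y (Ext.eq_zero_of_projective _)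
        (add_zero 1)
      obtain ⟨g, rfl⟩ := (Ext.linearEquiv₀ (R := K)).symm.surjective x₁
      exact ⟨g, hx₁⟩)

theorem finrank_ext_one_of_projective (K : Type u) [Field K] {C : Type v} [Category.{w} C]
    [Abelian C] [Linear K C] [HasExt.{x} C] {S : ShortComplex C} (hS : S.ShortExact)
    [Projective S.X₂] (Y : C) (h : ∀ g : S.X₂ ⟶ Y, S.f ≫ g = 0) {ι : Type*} [Fintype ι]
    (T : (ι → K) → (S.X₁ ⟶ Y)) (hadd : ∀ c d, T (c + d) = T c + T d)
    (hsmul : ∀ (r : K) c, T (r • c) = r • T c) (hT : Function.Bijective T) :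
    Module.finrank K (Ext S.X₃ Y 1) = Fintype.card ι := by
  let b : (ι → K) ≃ₗ[K] (S.X₁ ⟶ Y) :=
    LinearEquiv.ofBijective { toFun := T, map_add' := hadd, map_smul' := hsmul } hT
  rw [← (b.trans (extOneEquivOfProjective K hS Y h)).finrank_eq,
    Module.finrank_fintype_fun_eq_card]

namespace PathAlgebra

variable {K : Type u} {V : Type v} [Field K] [Quiver.{w} V] [Fintype V]
  {A : Type x} [Ring A] [Algebra K A] {f : PathAlgebra K V →ₐ[K] A}

/-- The radical of `P(i)`, as the kernel of the projection to `S(i)`. -/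
noncomputable abbrev projRad (f : PathAlgebra K V →ₐ[K] A) (i : V) :
    Submodule A (projMod (imageIdem f) i) :=
  LinearMap.ker (Module.jacobson A (projMod (imageIdem f) i)).mkQ

theorem projective_projMod (i : V) : Module.Projective A (projMod (imageIdem f) i) :=
  Module.Projective.of_split (projMod (imageIdem f) i).subtype
    (LinearMap.toSpanSingleton A _ (projGen (imageIdem f) i))
    (LinearMap.ext fun z => coe_smul_projGen imageIdem_mul_self z)

namespace IsAdmissiblePresentation

variable (hf : IsAdmissiblePresentation f)
include hf

theorem mem_projRad_iff {i : V} {z : projMod (imageIdem f) i} :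
    z ∈ projRad f i ↔ (z : A) ∈ imagePow f 1 := by
  rw [projRad, Submodule.ker_mkQ, hf.mem_jacobson_iff]

/-- The element `a e i` of `rad P(i)`, for `a` in the radical. -/
noncomputable def toProjRad (i : V) (a : A) (ha : a ∈ imagePow f 1) : projRad f i :=
  ⟨a • projGen (imageIdem f) i,
    hf.mem_projRad_iff.2 (mul_mem_imagePow_right hf.surjective (imageIdem f i) ha)⟩

theorem smul_toProjRad (i : V) (b a : A) (ha : a ∈ imagePow f 1) :
    b • hf.toProjRad i a ha =
      hf.toProjRad i (b * a) (mul_mem_imagePow_left hf.surjective b ha) :=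
  Subtype.ext (Subtype.ext (mul_assoc b a (imageIdem f i)).symm)

/-- `rad P(i)` is spanned by paths of positive length starting at `i`. A homomorphism to `S(j)`
kills paths of length at least two, since the radical annihilates `S(j)`, and arrows ending at `b ≠
j`, since `e b` does. -/
theorem eq_zero_of_forall_arrow {i j : V}
    (h : projRad f i →ₗ[A] simpleMod (imageIdem f) j)
    (hh : ∀ α : i ⟶ j, h (hf.toProjRad i (f (ofPath K (QPath.ofHom α)))
      (map_mem_imagePow (ofPath_mem_arrowPow le_rfl))) = 0) : h = 0 := by
  classical
  have key : ∀ x (hx : x ∈ arrowPow K V 1), h (hf.toProjRad i (f x) (map_mem_imagePow hx)) = 0 := by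
    intro x hx
    induction hx using Submodule.span_induction with
    | mem x hx =>
      obtain ⟨p, hp, rfl⟩ := hx
      obtain ⟨a, b, p⟩ := p
      by_cases ha : a = i
      · subst ha
        match p, hp with
        | .cons .nil α, _ =>
          by_cases hb : b = j
          · subst hb
            exact hh α
          · have h1 : imageIdem f b * f (ofPath K (QPath.ofHom α)) =
                f (ofPath K (QPath.ofHom α)) := by
              rw [imageIdem, ← map_mul, idem_mul_ofPath]
              exact congrArg f (if_pos rfl)
            have h2 := hf.smul_toProjRad a (imageIdem f b) (f (ofPath K (QPath.ofHom α)))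
              (map_mem_imagePow (ofPath_mem_arrowPow le_rfl))
            simp only [h1] at h2
            obtain ⟨c, hc⟩ := hf.exists_eq_smul_simpleGen (h (hf.toProjRad a
              (f (ofPath K (QPath.ofHom α))) (map_mem_imagePow (ofPath_mem_arrowPow le_rfl))))
            have h3 := congrArg h h2
            rw [map_smul] at h3
            refine h3.symm.trans ?_
            rw [hc, ← mul_smul, ← Algebra.commutes, mul_smul, hf.smul_simpleGen,
              hf.vertexForm_imageIdem, if_neg hb, map_zero, zero_smul, smul_zero]
        | .cons (.cons p β) α, _ =>
          have hq : ofPath K ⟨a, _, p.cons β⟩ ∈ arrowPow K V 1 :=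
            ofPath_mem_arrowPow (Nat.succ_le_succ (Nat.zero_le _))
          have hα : f (ofPath K (QPath.ofHom α)) ∈ imagePow f 1 :=
            map_mem_imagePow (ofPath_mem_arrowPow le_rfl)
          have h2 := hf.smul_toProjRad a (f (ofPath K (QPath.ofHom α)))
            (f (ofPath K ⟨a, _, p.cons β⟩)) (map_mem_imagePow hq)
          simp only [← map_mul, ← ofPath_cons] at h2
          rw [← h2, map_smul]
          obtain ⟨c, hc⟩ := hf.exists_eq_smul_simpleGen (h (hf.toProjRad a
              (f (ofPath K ⟨a, _, p.cons β⟩)) (map_mem_imagePow hq)))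
          rw [hc, ← mul_smul, ← Algebra.commutes, mul_smul, hf.smul_simpleGen,
            hf.vertexForm_eq_zero _ hα, map_zero, zero_smul, smul_zero]
      · have h1 : hf.toProjRad i (f (ofPath K ⟨a, b, p⟩)) (map_mem_imagePow
            (ofPath_mem_arrowPow hp)) = 0 := by
          refine Subtype.ext (Subtype.ext ?_)
          change f (ofPath K ⟨a, b, p⟩) * f (idem K i) = 0
          rw [← map_mul, ofPath_mul_idem, if_neg ha, map_zero]
        rw [h1, map_zero]
    | zero =>
      have h1 : hf.toProjRad i (f 0) (map_mem_imagePow (Submodule.zero_mem _)) = 0 := by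
        refine Subtype.ext (Subtype.ext ?_)
        change f 0 * imageIdem f i = 0
        rw [map_zero, zero_mul]
      rw [h1, map_zero]
    | add x y hx hy ihx ihy =>
      have h1 : hf.toProjRad i (f (x + y)) (map_mem_imagePow (Submodule.add_mem _ hx hy)) =
          hf.toProjRad i (f x) (map_mem_imagePow hx) +
          hf.toProjRad i (f y) (map_mem_imagePow hy) := by
        refine Subtype.ext (Subtype.ext ?_)
        change f (x + y) * imageIdem f i = f x * imageIdem f i + f y * imageIdem f i
        rw [map_add, add_mul]
      rw [h1, map_add, ihx, ihy, add_zero]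
    | smul c x hx ih =>
      have h1 : hf.toProjRad i (f (c • x)) (map_mem_imagePow (Submodule.smul_mem _ c hx)) =
          algebraMap K A c • hf.toProjRad i (f x) (map_mem_imagePow hx) := by
        refine Subtype.ext (Subtype.ext ?_)
        change f (c • x) * imageIdem f i = algebraMap K A c * (f x * imageIdem f i)
        rw [map_smul, ← Algebra.smul_def, smul_mul_assoc]
      rw [h1, map_smul, ih, smul_zero]
  ext z
  obtain ⟨x, hx, hxz⟩ := hf.mem_projRad_iff.1 z.2
  have h1 : z = hf.toProjRad i (f x) (map_mem_imagePow hx) := by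
    refine Subtype.ext (Subtype.ext ?_)
    change ((z : projMod (imageIdem f) i) : A) = f x * imageIdem f i
    rw [show f x = _ from hxz, coe_mul_idem imageIdem_mul_self]
  rw [h1]
  exact key x hx

variable [∀ i j : V, Fintype (i ⟶ j)]

/-- The homomorphism `rad P(i) → S(j)` with prescribed values on the arrows `i → j`. -/
noncomputable def radHom (i j : V) (c : (i ⟶ j) → K) :
    projRad f i →ₗ[A] simpleMod (imageIdem f) j where
  toFun z := algebraMap K A (∑ α, c α * hf.arrowForm α ((z : projMod (imageIdem f) i) : A)) •
    simpleGen f j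
  map_add' y z := by
    change algebraMap K A (∑ α, c α * hf.arrowForm α
      (((y : projMod (imageIdem f) i) : A) + ((z : projMod (imageIdem f) i) : A))) • _ = _
    simp only [map_add, mul_add, Finset.sum_add_distrib, add_smul]
  map_smul' a z := by
    change algebraMap K A (∑ α, c α * hf.arrowForm α (a * ((z : projMod (imageIdem f) i) : A))) •
      _ = a • algebraMap K A _ • _
    rw [← mul_smul a, ← Algebra.commutes, mul_smul, hf.smul_simpleGen j a, ← mul_smul, ← map_mul]
    -- On the radical each arrow coefficient transforms under `a` by the same character as `S(j)`.
    simp only [hf.arrowForm_mul _ a (hf.mem_projRad_iff.1 z.2)]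
    rw [Finset.sum_mul]
    congr 2
    exact Finset.sum_congr rfl fun α _ => by ring

theorem radHom_toProjRad {i j : V} (c : (i ⟶ j) → K) (α : i ⟶ j) :
    hf.radHom i j c (hf.toProjRad i (f (ofPath K (QPath.ofHom α)))
      (map_mem_imagePow (ofPath_mem_arrowPow le_rfl))) = algebraMap K A (c α) • simpleGen f j := by
  classical
  have h1 : f (ofPath K (QPath.ofHom α)) * imageIdem f i = f (ofPath K (QPath.ofHom α)) := by
    rw [imageIdem, ← map_mul, ofPath_mul_idem]
    exact congrArg f (if_pos rfl)
  change algebraMap K A (∑ β, c β * hf.arrowForm β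
    (f (ofPath K (QPath.ofHom α)) * imageIdem f i)) • simpleGen f j = _
  simp [h1, hf.arrowForm_ofHom]

theorem radHom_injective (i j : V) : Function.Injective (hf.radHom i j) := by
  intro c d hcd
  ext α
  have h1 : algebraMap K A (c α) • simpleGen f j = algebraMap K A (d α) • simpleGen f j := by
    rw [← hf.radHom_toProjRad, hcd, hf.radHom_toProjRad]
  rw [← sub_eq_zero, ← sub_smul, ← map_sub, hf.algebraMap_smul_simpleGen_eq_zero_iff] at h1
  exact sub_eq_zero.1 h1

theorem radHom_surjective (i j : V) : Function.Surjective (hf.radHom i j) := by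
  intro g
  choose c hc using fun α : i ⟶ j => hf.exists_eq_smul_simpleGen
    (g (hf.toProjRad i (f (ofPath K (QPath.ofHom α)))
      (map_mem_imagePow (ofPath_mem_arrowPow le_rfl))))
  refine ⟨c, sub_eq_zero.1 (hf.eq_zero_of_forall_arrow _ fun α => ?_)⟩
  rw [LinearMap.sub_apply, hf.radHom_toProjRad, sub_eq_zero]
  exact (hc α).symm

theorem radHom_add {i j : V} (c d : (i ⟶ j) → K) :
    hf.radHom i j (c + d) = hf.radHom i j c + hf.radHom i j d := by
  ext z
  change algebraMap K A _ • simpleGen f j =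
    algebraMap K A _ • simpleGen f j + algebraMap K A _ • simpleGen f j
  simp only [Pi.add_apply, add_mul, Finset.sum_add_distrib, map_add, add_smul]

theorem radHom_smul {i j : V} (r : K) (c : (i ⟶ j) → K) (z : projRad f i) :
    hf.radHom i j (r • c) z = algebraMap K A r • hf.radHom i j c z := by
  change algebraMap K A _ • simpleGen f j = algebraMap K A r • algebraMap K A _ • simpleGen f j
  simp only [Pi.smul_apply, smul_eq_mul, mul_assoc, ← Finset.mul_sum, map_mul, mul_smul]

end IsAdmissiblePresentation

theorem extArrows_eq_card [∀ i j : V, Finite (i ⟶ j)] (hf : IsAdmissiblePresentation f) (i j : V) :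
    extArrows K (imageIdem f) i j = Nat.card (i ⟶ j) := by
  have := fun i j : V => Fintype.ofFinite (i ⟶ j)
  let J := Module.jacobson A (projMod (imageIdem f) i)
  have hS := LinearMap.shortExact_shortComplexKer J.mkQ_surjective
  have : Projective (J.mkQ.shortComplexKer).X₂ :=
    (IsProjective.iff_projective _).1 (projective_projMod (f := f) i)
  -- A map `P(i) → S(j)` carries radical to radical, and the radical of `S(j)` is zero; so no
  -- nonzero map on `rad P(i)` extends to `P(i)`.
  have h0 : ∀ g : (J.mkQ.shortComplexKer).X₂ ⟶ ModuleCat.of A (simpleMod (imageIdem f) j),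
      (J.mkQ.shortComplexKer).f ≫ g = 0 := fun g => by
    ext z
    have h1 : (z : projMod (imageIdem f) i) ∈ J := (Submodule.Quotient.mk_eq_zero J).1 z.2
    have h2 := Module.le_comap_jacobson g.hom h1
    rw [Submodule.mem_comap, Module.jacobson_quotient_jacobson, Submodule.mem_bot] at h2
    exact h2
  rw [extArrows, Nat.card_eq_fintype_card]
  exact finrank_ext_one_of_projective K hS _ h0 (fun c => ModuleCat.ofHom (hf.radHom i j c))
    (fun c d => ModuleCat.hom_ext (hf.radHom_add c d))
    (fun r c => ModuleCat.hom_ext (LinearMap.ext (hf.radHom_smul r c)))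
    ⟨fun c d h => hf.radHom_injective i j (congrArg ModuleCat.Hom.hom h), fun g =>
      (hf.radHom_surjective i j g.hom).imp fun c hc => ModuleCat.hom_ext hc⟩

end PathAlgebra

end ExtOne

theorem mainTheorem1 {K : Type u} [Field K] [IsAlgClosed K]
    {V : Type v} [Fintype V] [Quiver.{w} V] [∀ i j : V, Finite (i ⟶ j)] [PartialOrder V]
    (I : Ideal (PathAlgebra K V)) [I.IsTwoSided] (hI : PathAlgebra.IsAdmissible I)
    (hA : IsOneQuasiHereditary K (PathAlgebra.quotIdem I)) :
    -- the given quiver is the `Ext`-quiver of `A = K V / I`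
    (∀ i j : V, extArrows K (PathAlgebra.quotIdem I) i j = Nat.card (i ⟶ j)) ∧
    -- two vertices are joined by an arrow if and only if they are neighbours
    (∀ i j : V, (Nonempty (i ⟶ j) ∨ Nonempty (j ⟶ i)) ↔ (i ⋖ j ∨ j ⋖ i)) ∧
    -- between neighbours there is exactly one arrow in each direction
    (∀ i j : V, (i ⋖ j ∨ j ⋖ i) → Nat.card (i ⟶ j) = 1 ∧ Nat.card (j ⟶ i) = 1) := by
  have hf : PathAlgebra.IsAdmissiblePresentation (Ideal.Quotient.mkₐ K I) :=
    { surjective := Ideal.Quotient.mk_surjective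
      ker_le := fun y hy => hI.2.1 y (Ideal.Quotient.eq_zero_iff_mem.1 hy)
      le_ker := by
        obtain ⟨m, -, hm⟩ := hI.2.2
        exact ⟨m, fun y hy => Ideal.Quotient.eq_zero_iff_mem.2 (hm y hy)⟩ }
  have he : PathAlgebra.quotIdem I = PathAlgebra.imageIdem (Ideal.Quotient.mkₐ K I) := rfl
  rw [he] at hA ⊢
  have hcard : ∀ i j : V, (i ⋖ j ∨ j ⋖ i) → Nat.card (i ⟶ j) = 1 := fun i j hij =>
    PathAlgebra.card_hom_eq_one_of_neighbours hf hA hij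
  refine ⟨PathAlgebra.extArrows_eq_card hf, fun i j => ⟨?_, fun h => ?_⟩, fun i j h =>
    ⟨hcard i j h, hcard j i h.symm⟩⟩
  · rintro (⟨⟨α⟩⟩ | ⟨⟨α⟩⟩)
    · exact PathAlgebra.neighbours_of_hom hf hA α
    · exact (PathAlgebra.neighbours_of_hom hf hA α).symm
  · exact Or.inl (Nat.card_ne_zero.1 (by rw [hcard i j h]; exact one_ne_zero)).1
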